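/- **Notation.** Let $n\ge 1$. $B_r(y)$ is the open Euclidean ball in $\mathbb R^n$, $(f)_B=\frac1{|B|}\int_B f\,dx$, and a weight is a locally integrable function $\omega:\mathbb R^n\to[0,\infty)$ with $\omega>0$ almost everywhere. Put $\mu=\omega^{-n}$. We write $\omega\in A_{1+\frac1n}$ if $$[\omega]_{A_{1+\frac1n}}=\sup_{x_0\in\mathbb R^n,\ \rho>0}(\omega)_{B_\rho(x_0)}\,(\omega^{-n})_{B_\rho(x_0)}^{1/n}<\infty .$$ For an open set $\Omega\subset\mathbb R^n$ let $$[[\omega]]_{\mathrm{BMO}(\Omega,\omega)}=\sup_{B=B_\rho(x_0)\subset\Omega}\Big(\frac1{\int_B\omega\,dx}\int_B|\omega-(\omega)_B|^{n+1}\,\omega^{-n}\,dx\Big)^{\frac1{n+1}} .$$ For $Y=(y,s)\in\mathbb R^n\times\mathbb R$ and $r>0$ let $C_{r,\mu}(Y)=B_r(y)\times\big(s-r^2(\mu)_{B_r(y)}^{1/n},\,s\big)$. Let $$\mathcal L u=u_t-\omega(x)\sum_{i,j=1}^n a_{ij}(x,t)D_{ij}u .$$ $C^{2,1}(\Omega)$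 is the space of continuous functions on an open set $\Omega\subset\mathbb R^{n+1}$ whose derivatives $u_t,D_iu,D_{ij}u$ exist and are continuous in $\Omega$. **Corollary 3.6 (Prop-up Lemma).** For every $n\ge1$, $\nu\in(0,1)$, $K_0\in[1,\infty)$ and $h\in(0,1]$ there exist $\gamma=\gamma(n,\nu,K_0,h)>0$ and $\bar\epsilon_2=\bar\epsilon_2(n,\nu,K_0,h)\in(0,1)$ such that the following holds. Let $r>0$, $Y=(y,s)\in\mathbb R^{n}\times\mathbb R$, and let $\omega\in A_{1+\frac1n}$ satisfy $$[\omega]_{A_{1+\frac1n}}\le K_0\qquad\text{and}\qquad [[\omega]]_{\mathrm{BMO}(B_{2r}(y),\omega)}\le\bar\epsilon_2 .$$ Let $(a_{ij})$ be a measurable symmetric matrix function with $\nu|\xi|^2\le \sum_{i,j}a_{ij}(x,t)\xi_i\xi_j$ for all $\xi\in\mathbb R^n$ and $|a_{ij}(x,t)|\le\nu^{-1}$ for all $i,j$, at every $(x,t)\in C_{r,\mu}(Y)$. Let $u\in C^{2,1}(C_{r,\mu}(Y))\cap C(\overline{C_{r,\mu}(Y)})$ satisfy $u\ge0$ in $C_{r,\mu}(Y)$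 and $\mathcal L u\ge0$ almost everywhere in $C_{r,\mu}(Y)$. Then $$\inf_{B_\rho(z)}u(\cdot,\tau)\le\Big(\frac{4r}{\rho}\Big)^{\gamma}\inf_{B_{r/2}(y)}u(\cdot,\sigma)$$ for all $\rho\in(0,r]$, $z\in\mathbb R^n$ and $\tau,\sigma\in\mathbb R$ such that $$B_\rho(z)\subset B_r(y)\qquad\text{and}\qquad s-r^2(\mu)_{B_r(y)}^{1/n}\le\tau<\tau+h\,r^2(\mu)_{B_r(y)}^{1/n}\le\sigma\le s .$$ -/

import Mathlib

open MeasureTheory Metric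

open scoped ENNReal

noncomputable section

namespace PropUp

/-- Points of `ℝⁿ` (with the Euclidean norm). -/
abbrev Space (n : ℕ) : Type := EuclideanSpace ℝ (Fin n)

/-- Points `X = (x, t)` of `ℝⁿ⁺¹ = ℝⁿ × ℝ`. -/
abbrev SpaceTime (n : ℕ) : Type := Space n × ℝ

/-! ### Muckenhoupt weights -/

/-- The Muckenhoupt constant `[σ]_{A_p}`, `1 < p < ∞`, of a non-negative function `σ`:
the supremum over all balls `B` of `(σ)_B * ((σ ^ (-1/(p-1)))_B) ^ (p-1)`, as an extended
non-negative number (the function `σ ^ (-1/(p-1))` is `∞` where `σ` vanishes). -/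
def muckenhouptConst {n : ℕ} (p : ℝ) (σ : Space n → ℝ) : ℝ≥0∞ :=
  ⨆ (x₀ : Space n) (ρ : ℝ) (_ : 0 < ρ),
    ((∫⁻ x in ball x₀ ρ, ENNReal.ofReal (σ x)) / volume (ball x₀ ρ)) *
      ((∫⁻ x in ball x₀ ρ, ENNReal.ofReal (σ x) ^ (-(1 / (p - 1)))) /
        volume (ball x₀ ρ)) ^ (p - 1)

/-- The class `A_p`, `1 < p < ∞`. The clause `pos_ae` only excludes `σ = 0` almost everywhere:
for any other `σ` it follows from the finiteness of `[σ]_{A_p}`. -/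
structure IsMuckenhoupt {n : ℕ} (p : ℝ) (σ : Space n → ℝ) : Prop where
  nonneg : ∀ x, 0 ≤ σ x
  locallyIntegrable : LocallyIntegrable σ volume
  pos_ae : ∀ᵐ x, 0 < σ x
  const_lt_top : muckenhouptConst p σ < ∞

/-! ### Weighted mean oscillation -/

/-- The mean oscillation of `f` on the ball `B_r(y)` with respect to the weight `ω`:
`(ω(B)⁻¹ ∫_B |f - (f)_B| ^ (n+1) ω ^ (-n) dx) ^ (1/(n+1))` with `B = B_r(y)`. -/
def meanOsc {n : ℕ} (ω f : Space n → ℝ) (y : Space n) (r : ℝ) : ℝ≥0∞ :=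
  ((∫⁻ x in ball y r, ENNReal.ofReal |f x - ⨍ x' in ball y r, f x'| ^ (n + 1) *
      ENNReal.ofReal (ω x) ^ (-(n : ℝ))) /
    ∫⁻ x in ball y r, ENNReal.ofReal (ω x)) ^ (1 / ((n : ℝ) + 1))

/-- The weighted BMO seminorm of `f` on `Ω`: the supremum of the mean oscillations with respect
to `ω` over all balls contained in `Ω`. -/
def bmoSeminorm {n : ℕ} (ω f : Space n → ℝ) (Ω : Set (Space n)) : ℝ≥0∞ :=
  ⨆ (y : Space n) (r : ℝ) (_ : 0 < r) (_ : ball y r ⊆ Ω), meanOsc ω f y r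

/-! ### Weighted parabolic cylinders -/

/-- The weight `μ(x) = ω(x) ^ (-n)`. -/
def dualWeight {n : ℕ} (ω : Space n → ℝ) (x : Space n) : ℝ := (ω x ^ n)⁻¹

/-- `r² (μ)_{B_r(y)}^{1/n}`, the height of the weighted parabolic cylinder. -/
def cylinderHeight {n : ℕ} (μ : Space n → ℝ) (r : ℝ) (y : Space n) : ℝ :=
  r ^ 2 * (⨍ x in ball y r, μ x) ^ (1 / (n : ℝ))

/-- The weighted parabolic cylinder
`C_{r,μ}(Y) = B_r(y) × (s - r² (μ)_{B_r(y)}^{1/n}, s)`, `Y = (y, s)`. -/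
def cylinder {n : ℕ} (μ : Space n → ℝ) (r : ℝ) (Y : SpaceTime n) : Set (SpaceTime n) :=
  ball Y.1 r ×ˢ Set.Ioo (Y.2 - cylinderHeight μ r Y.1) Y.2

/-! ### The parabolic operator -/

/-- The spatial coordinate direction `e_i` in `ℝⁿ × ℝ`. -/
def eSpace {n : ℕ} (i : Fin n) : SpaceTime n := (EuclideanSpace.single i 1, 0)

/-- The time direction in `ℝⁿ × ℝ`. -/
def eTime (n : ℕ) : SpaceTime n := (0, 1)

/-- The partial derivative `D_i u`. -/
def spaceDeriv {n : ℕ} (i : Fin n) (u : SpaceTime n → ℝ) (X : SpaceTime n) : ℝ :=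
  lineDeriv ℝ u X (eSpace i)

/-- The partial derivative `u_t`. -/
def timeDeriv {n : ℕ} (u : SpaceTime n → ℝ) (X : SpaceTime n) : ℝ :=
  lineDeriv ℝ u X (eTime n)

/-- `u ∈ C^{2,1}(Ω)` for an open set `Ω ⊆ ℝⁿ × ℝ`: `u` is continuous in `Ω`, the partial
derivatives `u_t`, `D_i u`, `D_{ij} u` exist at all points of `Ω` and are continuous in `Ω`. -/
structure IsC21On {n : ℕ} (u : SpaceTime n → ℝ) (Ω : Set (SpaceTime n)) : Prop where
  continuousOn : ContinuousOn u Ω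
  time_diff : ∀ X ∈ Ω, LineDifferentiableAt ℝ u X (eTime n)
  time_cont : ContinuousOn (timeDeriv u) Ω
  space_diff : ∀ i, ∀ X ∈ Ω, LineDifferentiableAt ℝ u X (eSpace i)
  space_cont : ∀ i, ContinuousOn (spaceDeriv i u) Ω
  space2_diff : ∀ i j, ∀ X ∈ Ω, LineDifferentiableAt ℝ (spaceDeriv j u) X (eSpace i)
  space2_cont : ∀ i j, ContinuousOn (spaceDeriv i (spaceDeriv j u)) Ω

/-- `(a_{ij})` is a measurable symmetric coefficient matrix in `Ω` with
`ν |ξ|² ≤ a_{ij} ξ_i ξ_j` and `|a_{ij}| ≤ ν⁻¹` at every point of `Ω`. -/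
structure IsElliptic {n : ℕ} (ν : ℝ) (a : SpaceTime n → Matrix (Fin n) (Fin n) ℝ)
    (Ω : Set (SpaceTime n)) : Prop where
  aemeasurable : ∀ i j, AEMeasurable (fun X => a X i j) (volume.restrict Ω)
  symm : ∀ X ∈ Ω, (a X).IsSymm
  lower : ∀ X ∈ Ω, ∀ ξ : Space n, ν * ‖ξ‖ ^ 2 ≤ ∑ i, ∑ j, a X i j * ξ i * ξ j
  upper : ∀ X ∈ Ω, ∀ i j, |a X i j| ≤ ν⁻¹

/-- The operator `𝓛 u = u_t - ω(x) a_{ij}(x,t) D_{ij} u`. -/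
def parabolicOp {n : ℕ} (ω : Space n → ℝ) (a : SpaceTime n → Matrix (Fin n) (Fin n) ℝ)
    (u : SpaceTime n → ℝ) (X : SpaceTime n) : ℝ :=
  timeDeriv u X - ω X.1 * ∑ i, ∑ j, a X i j * spaceDeriv i (spaceDeriv j u) X

end PropUp

end

noncomputable section

namespace PropUp

open Filter Topology Set
open scoped RealInnerProductSpace

/-! ### Calculus in several variables -/

/-! Positivity spreads from a ball to one of twice its radius at the cost of a fixed factor `c`
(`exists_one_step`), and `exists_chain` iterates this. About log₂(r/ρ) doublings lead from B_ρ(z) to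
B_r(y), so the loss is a power of r/ρ with exponent log₂(1/c). The waiting times fit into h times
the full height because the height of a cylinder is R (∫_{B_R} μ / |B_1|)^{1/n}: by
`cylinderHeight_le` it decreases at least linearly in the radius along nested balls, and the times
add up geometrically.

For one step let m be the mean of ω on B_R(w). The explicit `barrier` ψ is positive only in a ball
moving from B_{R/4}(z) to B_{3R/4}(w). There it is a subsolution of the equation with ω frozen at m
(`barrier_subsolution`). It starts below u, and at the final time it is at least 2cM on B_{R/2}(w).
Its decay depends only on mT/R², which the Muckenhoupt condition bounds above and, with the lower
bound on T, below. Hence `c` is uniform.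

Where ψ > 0, the difference ψ - u satisfies the true inequality with right side |ω - m| |a_ij D_ij
ψ|. The parabolic Aleksandrov–Bakelman–Pucci–Krylov–Tso estimate (`volume_le_of_subsolution`)
controls its maximum by the integral of |ω - m|^{n+1} ω^{-n}, which is exactly what the BMO seminorm
measures. If that is small, then ψ - u ≤ cM (`barrier_sub_le`), so u ≥ cM at the end.

The maximum estimate comes from the area formula for (x, t) ↦ (∇V, V - ⟨∇V, x - w⟩), whose Jacobian
is V_t det D²V. A C^{2,1} function need not have a gradient differentiable in time, so it is
replaced by its piecewise affine interpolation in time (`volume_le_of_slab`). The errors vanish as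
the mesh is refined. -/

/-- A function whose partial derivatives exist near `x` and are continuous at `x` is differentiable
at `x`. -/
theorem hasFDerivAt_of_partial {n : ℕ} {f : Space n → ℝ} {d : Fin n → Space n → ℝ} {x : Space n}
    (hf : ∀ i, ∀ᶠ y in 𝓝 x, HasLineDerivAt ℝ f (d i y) y (EuclideanSpace.single i 1))
    (hd : ∀ i, ContinuousAt (d i) x) :
    HasFDerivAt f (innerSL ℝ (WithLp.toLp 2 fun i => d i x : Space n)) x := by
  -- Coordinates are added one at a time. Uniformity in the base point y is what the induction
  -- needs: the remaining coordinates are handled from the shifted point y + ξ_j e_j.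
  have key : ∀ (s : Finset (Fin n)) (ε : ℝ), 0 < ε → ∃ δ > 0, ∀ y ξ : Space n, dist y x < δ →
      ‖ξ‖ < δ → |f (y + ∑ i ∈ s, ξ i • EuclideanSpace.single i 1) - f y - ∑ i ∈ s, d i x * ξ i|
        ≤ ε * ‖ξ‖ := by
    intro s
    induction s using Finset.induction_on with
    | empty =>
      intro ε hε
      refine ⟨1, one_pos, fun y ξ _ _ => ?_⟩
      simp only [Finset.sum_empty, add_zero, sub_self, abs_zero]
      positivity
    | insert j s hj ih =>
      intro ε hε
      obtain ⟨δ₁, hδ₁, h₁⟩ := ih (ε / 2) (half_pos hε)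
      have hev : ∀ᶠ y in 𝓝 x, HasLineDerivAt ℝ f (d j y) y (EuclideanSpace.single j 1) ∧
          |d j y - d j x| < ε / 2 := by
        refine (hf j).and ?_
        have := (Metric.tendsto_nhds.1 (hd j)) (ε / 2) (half_pos hε)
        simpa only [Real.dist_eq] using this
      obtain ⟨δ₂, hδ₂, h₂⟩ := Metric.eventually_nhds_iff.1 hev
      refine ⟨min (δ₁ / 2) (δ₂ / 2), lt_min (half_pos hδ₁) (half_pos hδ₂), fun y ξ hy hξ => ?_⟩
      have hy1 := lt_of_lt_of_le hy (min_le_left _ _)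
      have hy2 := lt_of_lt_of_le hy (min_le_right _ _)
      have hξ1 := lt_of_lt_of_le hξ (min_le_left _ _)
      have hξ2 := lt_of_lt_of_le hξ (min_le_right _ _)
      have hcoord : |ξ j| ≤ ‖ξ‖ := by
        simpa using PiLp.norm_apply_le ξ j
      set e : Space n := EuclideanSpace.single j 1 with he
      have hen : ‖e‖ = 1 := by simp [he]
      rw [Finset.sum_insert hj, Finset.sum_insert hj, ← add_assoc]
      set z : Space n := ∑ i ∈ s, ξ i • EuclideanSpace.single i 1 with hz
      have hseg : ∀ τ ∈ uIcc (0 : ℝ) (ξ j), dist (y + τ • e) x < δ₂ := by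
        intro τ hτ
        have : |τ| ≤ |ξ j| := by
          rcases le_total 0 (ξ j) with h | h
          · rw [uIcc_of_le h] at hτ
            rw [abs_of_nonneg hτ.1, abs_of_nonneg h]; exact hτ.2
          · rw [uIcc_of_ge h] at hτ
            rw [abs_of_nonpos hτ.2, abs_of_nonpos h]; linarith [hτ.1]
        calc dist (y + τ • e) x ≤ dist (y + τ • e) y + dist y x := dist_triangle _ _ _
          _ = |τ| + dist y x := by simp [dist_eq_norm, norm_smul, hen]
          _ < δ₂ := by linarith
      have hstep : |f (y + ξ j • e) - f y - d j x * ξ j| ≤ ε / 2 * ‖ξ‖ := by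
        have hder : ∀ τ ∈ uIcc (0 : ℝ) (ξ j), HasDerivWithinAt
            (fun τ => f (y + τ • e) - d j x * τ) (d j (y + τ • e) - d j x)
            (uIcc (0 : ℝ) (ξ j)) τ := by
          intro τ hτ
          have h := (h₂ (hseg τ hτ)).1
          have h3 : HasDerivAt (fun τ : ℝ => f (y + τ • e)) (d j (y + τ • e)) τ := by
            have h4 : HasDerivAt (fun t : ℝ => f (y + τ • e + t • e)) (d j (y + τ • e)) 0 := h
            have h5 := HasDerivAt.scomp τ (h := fun t : ℝ => t - τ) (h' := 1)
              (g₁ := fun t : ℝ => f (y + τ • e + t • e)) (g₁' := d j (y + τ • e))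
              (by simpa using h4) ((hasDerivAt_id τ).sub_const τ)
            simp only [one_smul] at h5
            refine h5.congr_of_eventuallyEq (Eventually.of_forall fun t => ?_)
            simp only [Function.comp]
            congr 1
            rw [sub_smul]; abel
          have h6 : HasDerivAt (fun τ => d j x * τ) (d j x) τ := by
            simpa using (hasDerivAt_id τ).const_mul (d j x)
          exact (h3.sub h6).hasDerivWithinAt
        have hb := Convex.norm_image_sub_le_of_norm_hasDerivWithin_le hder
          (fun τ hτ => (h₂ (hseg τ hτ)).2.le) (convex_uIcc _ _) left_mem_uIcc right_mem_uIcc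
        simp only [zero_smul, add_zero, mul_zero, sub_zero, Real.norm_eq_abs] at hb
        calc _ = |f (y + ξ j • e) - d j x * ξ j - f y| := by congr 1; ring
          _ ≤ ε / 2 * |ξ j| := hb
          _ ≤ _ := by gcongr
      have hrest := h₁ (y + ξ j • e) ξ (by
        calc dist (y + ξ j • e) x ≤ dist (y + ξ j • e) y + dist y x := dist_triangle _ _ _
          _ = |ξ j| + dist y x := by simp [dist_eq_norm, norm_smul, hen]
          _ < δ₁ := by linarith) (by linarith)
      have hsplit : f (y + ξ j • e + z) - f y - (d j x * ξ j + ∑ i ∈ s, d i x * ξ i) =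
          (f (y + ξ j • e + z) - f (y + ξ j • e) - ∑ i ∈ s, d i x * ξ i) +
          (f (y + ξ j • e) - f y - d j x * ξ j) := by ring
      rw [hsplit]
      calc _ ≤ _ := abs_add_le _ _
        _ ≤ ε / 2 * ‖ξ‖ + ε / 2 * ‖ξ‖ := add_le_add hrest hstep
        _ = ε * ‖ξ‖ := by ring
  rw [hasFDerivAt_iff_isLittleO_nhds_zero, Asymptotics.isLittleO_iff]
  intro ε hε
  obtain ⟨δ, hδ, hk⟩ := key Finset.univ ε hε
  refine Metric.eventually_nhds_iff.2 ⟨δ, hδ, fun ξ hξ => ?_⟩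
  have h := hk x ξ (by simpa using hδ) (by simpa using hξ)
  have h1 : ∑ i, ξ i • EuclideanSpace.single i (1 : ℝ) = ξ := by
    have := (EuclideanSpace.basisFun (Fin n) ℝ).sum_repr ξ
    simpa using this
  rw [h1] at h
  rw [Real.norm_eq_abs]
  convert h using 3
  simp [PiLp.inner_apply, mul_comm]

/-- The linear map into `ℝⁿ` with components `g i`. -/
def ofComponents {n : ℕ} {E : Type*} [NormedAddCommGroup E] [NormedSpace ℝ E]
    (g : Fin n → E →L[ℝ] ℝ) : E →L[ℝ] Space n :=
  ∑ i, (g i).smulRight (EuclideanSpace.single i (1 : ℝ))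

/-- A map into `ℝⁿ` with differentiable components is differentiable. -/
theorem hasFDerivAt_toLp_of_components {n : ℕ} {E : Type*} [NormedAddCommGroup E]
    [NormedSpace ℝ E] {g : Fin n → E → ℝ} {g' : Fin n → E →L[ℝ] ℝ} {x : E}
    (hg : ∀ i, HasFDerivAt (g i) (g' i) x) :
    HasFDerivAt (fun y => (WithLp.toLp 2 fun i => g i y : Space n)) (ofComponents g') x := by
  have h : HasFDerivAt (fun y => ∑ i, g i y • (EuclideanSpace.single i (1 : ℝ) : Space n))
      (ofComponents g') x :=
    HasFDerivAt.fun_sum fun i _ => (hg i).smul_const _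
  refine h.congr_of_eventuallyEq (Eventually.of_forall fun y => ?_)
  have := (EuclideanSpace.basisFun (Fin n) ℝ).sum_repr (WithLp.toLp 2 fun i => g i y : Space n)
  simpa using this.symm

section SecondOrder

variable {E : Type*} [NormedAddCommGroup E] [InnerProductSpace ℝ E]

/-- The second derivative of a function is symmetric. -/
theorem inner_hessian_symm {V : E → ℝ} {G : E → E} {H : E →L[ℝ] E} {x : E}
    (hV : ∀ᶠ y in 𝓝 x, HasFDerivAt V (innerSL ℝ (G y)) y) (hG : HasFDerivAt G H x) (ξ η : E) :
    ⟪H ξ, η⟫ = ⟪H η, ξ⟫ := by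
  have h1 : HasFDerivAt (fun y => (innerSL ℝ (G y) : E →L[ℝ] ℝ)) ((innerSL ℝ).comp H) x :=
    (innerSL ℝ (E := E)).hasFDerivAt.comp x hG
  simpa using second_derivative_symmetric_of_eventually hV h1 ξ η

/-- At an interior maximum the gradient vanishes and the Hessian is nonpositive. -/
theorem hessian_nonpos_of_isLocalMax {V : E → ℝ} {G : E → E} {H : E →L[ℝ] E} {x : E}
    (hV : ∀ᶠ y in 𝓝 x, HasFDerivAt V (innerSL ℝ (G y)) y) (hG : HasFDerivAt G H x)
    (hmax : IsLocalMax V x) : G x = 0 ∧ ∀ ξ, ⟪H ξ, ξ⟫ ≤ 0 := by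
  have hG0 : G x = 0 := by
    have := hmax.hasFDerivAt_eq_zero hV.self_of_nhds
    have h2 : (innerSL ℝ (G x) : E →L[ℝ] ℝ) (G x) = 0 := by rw [this]; rfl
    simpa using h2
  refine ⟨hG0, fun ξ => ?_⟩
  by_contra! hpos
  set φ : ℝ → ℝ := fun s => V (x + s • ξ) with hφ
  have hline : ∀ s : ℝ, HasDerivAt (fun s : ℝ => x + s • ξ) ξ s := fun s => by
    simpa using ((hasDerivAt_id s).smul_const ξ).const_add x
  have hcont : Tendsto (fun s : ℝ => x + s • ξ) (𝓝 0) (𝓝 x) := by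
    have := (hline 0).continuousAt.tendsto
    simpa using this
  have hder : ∀ᶠ s in 𝓝 (0 : ℝ), HasDerivAt φ ⟪G (x + s • ξ), ξ⟫ s := by
    filter_upwards [hcont.eventually hV] with s hs
    exact hs.comp_hasDerivAt s (hline s)
  have hd1 : deriv φ =ᶠ[𝓝 0] fun s => ⟪G (x + s • ξ), ξ⟫ := hder.mono fun s hs => hs.deriv
  have hd2 : HasDerivAt (fun s : ℝ => ⟪G (x + s • ξ), ξ⟫) ⟪H ξ, ξ⟫ 0 := by
    have h1 : HasDerivAt (fun s : ℝ => G (x + s • ξ)) (H ξ) 0 :=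
      HasFDerivAt.comp_hasDerivAt (0 : ℝ) (by simpa using hG) (hline 0)
    simpa using h1.inner ℝ (hasDerivAt_const (0 : ℝ) ξ)
  have hd3 : deriv (deriv φ) 0 = ⟪H ξ, ξ⟫ := by rw [hd1.deriv_eq, hd2.deriv]
  -- A positive second derivative makes 0 a local minimum along the line as well as a local maximum.
  -- The restriction is then locally constant, so its second derivative is zero, a contradiction.
  have hmin : IsLocalMin φ 0 := by
    refine isLocalMin_of_deriv_deriv_pos (by rw [hd3]; exact hpos) ?_
      hder.self_of_nhds.continuousAt
    rw [hd1.self_of_nhds]; simp [hG0]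
  have hmax' : ∀ᶠ s in 𝓝 (0 : ℝ), φ s ≤ φ 0 := by
    filter_upwards [hcont.eventually hmax] with s hs
    simpa [hφ] using hs
  have hconst : φ =ᶠ[𝓝 0] fun _ => φ 0 := by
    filter_upwards [hmin, hmax'] with s h1 h2 using le_antisymm h2 h1
  have h0 : deriv φ =ᶠ[𝓝 0] fun _ => 0 := by
    have := hconst.deriv
    simpa using this
  have : deriv (deriv φ) 0 = 0 := by rw [h0.deriv_eq]; simp
  rw [hd3] at this
  exact hpos.ne' this

end SecondOrder

/-! ### Linear algebra -/

/-- The matrix of a bilinear form `⟪H ·, ·⟫` in the standard basis. -/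
def hessianMatrix {n : ℕ} (H : Space n →L[ℝ] Space n) : Matrix (Fin n) (Fin n) ℝ :=
  fun i j => H (EuclideanSpace.single i 1) j

theorem inner_apply_eq_hessianMatrix {n : ℕ} (H : Space n →L[ℝ] Space n) (ξ η : Space n) :
    ⟪H ξ, η⟫ = ∑ i, ∑ j, hessianMatrix H i j * ξ i * η j := by
  have h1 : ∑ i, ξ i • EuclideanSpace.single i (1 : ℝ) = ξ := by
    simpa using (EuclideanSpace.basisFun (Fin n) ℝ).sum_repr ξ
  conv_lhs => rw [← h1]
  simp only [map_sum, map_smul, sum_inner, real_inner_smul_left]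
  refine Finset.sum_congr rfl fun i _ => ?_
  simp only [PiLp.inner_apply, Finset.mul_sum, hessianMatrix]
  refine Finset.sum_congr rfl fun j _ => ?_
  simp
  ring

theorem det_eq_det_hessianMatrix {n : ℕ} (H : Space n →L[ℝ] Space n) :
    LinearMap.det (H : Space n →ₗ[ℝ] Space n) = (hessianMatrix H).det := by
  -- `hessianMatrix` stores the image of the i-th basis vector in row i, the transpose of the usual
  -- convention.
  rw [← LinearMap.det_toMatrix (EuclideanSpace.basisFun (Fin n) ℝ).toBasis, ← Matrix.det_transpose]
  congr 1

theorem posSemidef_neg_hessianMatrix {n : ℕ} {H : Space n →L[ℝ] Space n}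
    (hsymm : ∀ ξ η, ⟪H ξ, η⟫ = ⟪H η, ξ⟫) (hneg : ∀ ξ, ⟪H ξ, ξ⟫ ≤ 0) :
    (-hessianMatrix H).PosSemidef := by
  refine Matrix.PosSemidef.of_dotProduct_mulVec_nonneg ?_ fun x => ?_
  · ext i j
    have := hsymm (EuclideanSpace.single i 1) (EuclideanSpace.single j 1)
    simp [EuclideanSpace.inner_single_right] at this
    simp [hessianMatrix, this]
  · have := hneg (WithLp.toLp 2 x)
    rw [inner_apply_eq_hessianMatrix] at this
    simp only [dotProduct, Matrix.mulVec, Matrix.neg_apply, star_trivial, Finset.mul_sum]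
    rw [← neg_nonneg, ← Finset.sum_neg_distrib] at this
    refine this.trans_eq (Finset.sum_congr rfl fun i _ => ?_)
    rw [← Finset.sum_neg_distrib]
    refine Finset.sum_congr rfl fun j _ => ?_
    ring

/-- Each eigenvalue is at most the trace. The sharper arithmetic–geometric bound would only improve
constants. -/
theorem det_le_trace_pow {n : ℕ} {N : Matrix (Fin n) (Fin n) ℝ} (hN : N.PosSemidef) :
    N.det ≤ N.trace ^ n := by
  have h1 := hN.isHermitian.det_eq_prod_eigenvalues
  have h2 := hN.isHermitian.trace_eq_sum_eigenvalues
  simp only [RCLike.ofReal_real_eq_id, id] at h1 h2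
  rw [h1, h2]
  calc ∏ i, hN.isHermitian.eigenvalues i
      ≤ ∏ _i : Fin n, ∑ j, hN.isHermitian.eigenvalues j :=
        Finset.prod_le_prod (fun i _ => hN.eigenvalues_nonneg i) fun i _ =>
          Finset.single_le_sum (fun j _ => hN.eigenvalues_nonneg j) (Finset.mem_univ i)
    _ = _ := by simp

open scoped Matrix MatrixOrder Matrix.Norms.L2Operator in
/-- If `a ≥ ν` and `N ≥ 0`, then `tr (a N) ≥ ν tr N`. -/
theorem mul_trace_le_of_posSemidef {n : ℕ} {ν : ℝ} {a N : Matrix (Fin n) (Fin n) ℝ}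
    (ha : ∀ ξ : Space n, ν * ‖ξ‖ ^ 2 ≤ ∑ i, ∑ j, a i j * ξ i * ξ j) (hN : N.PosSemidef) :
    ν * N.trace ≤ ∑ i, ∑ j, a i j * N i j := by
  -- With N = BᵀB, both sides become sums over the rows of B, and ellipticity is applied to each
  -- row.
  obtain ⟨B, rfl⟩ : ∃ B : Matrix (Fin n) (Fin n) ℝ, N = Bᴴ * B :=
    CStarAlgebra.nonneg_iff_eq_star_mul_self.mp hN.nonneg
  have hsum := Finset.sum_le_sum (s := Finset.univ)
    fun k (_ : k ∈ Finset.univ) => ha (WithLp.toLp 2 fun i => B k i)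
  calc ν * (Bᴴ * B).trace = ∑ k, ν * ‖(WithLp.toLp 2 fun i => B k i : Space n)‖ ^ 2 := by
        simp only [Matrix.trace, Matrix.diag, Matrix.mul_apply, Matrix.conjTranspose_apply,
          star_trivial, EuclideanSpace.real_norm_sq_eq]
        rw [Finset.sum_comm, Finset.mul_sum]
        simp [sq]
    _ ≤ _ := hsum
    _ = _ := by
        simp only [Matrix.mul_apply, Matrix.conjTranspose_apply, star_trivial, Finset.mul_sum]
        rw [Finset.sum_comm]
        refine Finset.sum_congr rfl fun i _ => ?_
        rw [Finset.sum_comm]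
        refine Finset.sum_congr rfl fun j _ => Finset.sum_congr rfl fun k _ => ?_
        ring

theorem det_prod_upper {M : Type*} [AddCommGroup M] [Module ℝ M] [FiniteDimensional ℝ M]
    (H : M →ₗ[ℝ] M) (b : M) (c : ℝ) :
    LinearMap.det ((H.comp (LinearMap.fst ℝ M ℝ) + (LinearMap.snd ℝ M ℝ).smulRight b).prod
      (c • LinearMap.snd ℝ M ℝ)) = LinearMap.det H * c := by
  let e := Module.Free.chooseBasis ℝ M
  rw [← LinearMap.det_toMatrix (e.prod (Module.Basis.singleton Unit ℝ))]
  have : LinearMap.toMatrix (e.prod (Module.Basis.singleton Unit ℝ))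
      (e.prod (Module.Basis.singleton Unit ℝ))
      ((H.comp (LinearMap.fst ℝ M ℝ) + (LinearMap.snd ℝ M ℝ).smulRight b).prod
      (c • LinearMap.snd ℝ M ℝ)) = Matrix.fromBlocks (LinearMap.toMatrix e e H)
        (Matrix.of fun i _ => e.repr b i) 0 (Matrix.of fun _ _ => c) := by
    ext (i | i) (j | j) <;> simp [LinearMap.toMatrix_apply]
  rw [this, Matrix.det_fromBlocks_zero₂₁, LinearMap.det_toMatrix]
  simp

theorem det_prod_shear {M : Type*} [AddCommGroup M] [Module ℝ M] [FiniteDimensional ℝ M]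
    (l : M →ₗ[ℝ] ℝ) :
    LinearMap.det ((LinearMap.fst ℝ M ℝ).prod
      (LinearMap.snd ℝ M ℝ - l.comp (LinearMap.fst ℝ M ℝ))) = 1 := by
  let e := Module.Free.chooseBasis ℝ M
  rw [← LinearMap.det_toMatrix (e.prod (Module.Basis.singleton Unit ℝ))]
  have : LinearMap.toMatrix (e.prod (Module.Basis.singleton Unit ℝ))
      (e.prod (Module.Basis.singleton Unit ℝ))
      ((LinearMap.fst ℝ M ℝ).prod (LinearMap.snd ℝ M ℝ - l.comp (LinearMap.fst ℝ M ℝ))) =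
      Matrix.fromBlocks 1 0 (Matrix.of fun _ j => - l (e j)) 1 := by
    ext (i | i) (j | j) <;>
      simp [LinearMap.toMatrix_apply, Matrix.one_apply, Finsupp.single_apply, eq_comm]
  rw [this, Matrix.det_fromBlocks_zero₁₂]
  simp

/-- The derivative of `(x, t) ↦ (p, V - ⟪p, x⟫)`, where `p = ∇V`. -/
def legendreDeriv {n : ℕ} (H : Space n →L[ℝ] Space n) (b x : Space n) (c : ℝ) :
    Space n × ℝ →L[ℝ] Space n × ℝ :=
  (H.comp (ContinuousLinearMap.fst ℝ (Space n) ℝ) +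
      (ContinuousLinearMap.snd ℝ (Space n) ℝ).smulRight b).prod
    (c • ContinuousLinearMap.snd ℝ (Space n) ℝ - (innerSL ℝ x).comp
      (H.comp (ContinuousLinearMap.fst ℝ (Space n) ℝ) +
        (ContinuousLinearMap.snd ℝ (Space n) ℝ).smulRight b))

/-- The map is a shear of determinant one after a block triangular map with diagonal blocks H and c.
The vector b, the time derivative of the gradient, sits off the diagonal and drops out. -/
theorem det_legendreDeriv {n : ℕ} (H : Space n →L[ℝ] Space n) (b x : Space n) (c : ℝ) :
    (legendreDeriv H b x c).det = (hessianMatrix H).det * c := by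
  rw [← det_eq_det_hessianMatrix, ← det_prod_upper (H : Space n →ₗ[ℝ] Space n) b c]
  refine Eq.trans ?_ (one_mul _)
  rw [← det_prod_shear ((innerSL ℝ x : Space n →L[ℝ] ℝ) : Space n →ₗ[ℝ] ℝ), ← LinearMap.det_comp]
  congr 1

/-! ### The contact set of a function that is affine in time -/

/-- `f` is twice differentiable in `U`, with gradient `G` and continuous Hessian `H`. -/
structure HasHessianOn {n : ℕ} (f : Space n → ℝ) (G : Space n → Space n)
    (H : Space n → Space n →L[ℝ] Space n) (U : Set (Space n)) : Prop where
  grad : ∀ x ∈ U, HasFDerivAt f (innerSL ℝ (G x)) x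
  hess : ∀ x ∈ U, HasFDerivAt G (H x) x
  cont : ContinuousOn H U

theorem HasHessianOn.combo {n : ℕ} {f g : Space n → ℝ} {G G' : Space n → Space n}
    {H H' : Space n → Space n →L[ℝ] Space n} {U : Set (Space n)} (hf : HasHessianOn f G H U)
    (hg : HasHessianOn g G' H' U) (a b : ℝ) :
    HasHessianOn (fun x => a * f x + b * g x) (fun x => a • G x + b • G' x)
      (fun x => a • H x + b • H' x) U where
  grad x hx := by
    have := ((hf.grad x hx).const_mul a).add ((hg.grad x hx).const_mul b)
    refine this.congr_fderiv ?_
    ext ξ; simp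
  hess x hx := ((hf.hess x hx).const_smul a).add ((hg.hess x hx).const_smul b)
  cont := (hf.cont.const_smul a).add (hg.cont.const_smul b)

/-- Being affine in time, V = A + (t - t₀)B has a gradient that is jointly differentiable in (x, t).
In the second component ⟨∇V, dx⟩ cancels, leaving V_t dt - ⟨d∇V, x - w⟩. -/
theorem hasFDerivAt_legendre {n : ℕ} {A B : Space n → ℝ} {GA GB : Space n → Space n}
    {HA HB : Space n → Space n →L[ℝ] Space n} {U : Set (Space n)}
    (hA : HasHessianOn A GA HA U) (hB : HasHessianOn B GB HB U) (w : Space n) (t₀ : ℝ)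
    {X : Space n × ℝ} (hX : X.1 ∈ U) :
    HasFDerivAt (fun Y : Space n × ℝ => (GA Y.1 + (Y.2 - t₀) • GB Y.1,
      A Y.1 + (Y.2 - t₀) * B Y.1 - ⟪GA Y.1 + (Y.2 - t₀) • GB Y.1, Y.1 - w⟫))
      (legendreDeriv (HA X.1 + (X.2 - t₀) • HB X.1) (GB X.1) (X.1 - w) (B X.1)) X := by
  have hfst : HasFDerivAt (fun Y : Space n × ℝ => Y.1) (ContinuousLinearMap.fst ℝ (Space n) ℝ) X :=
    hasFDerivAt_fst
  have hsnd : HasFDerivAt (fun Y : Space n × ℝ => Y.2 - t₀)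
      (ContinuousLinearMap.snd ℝ (Space n) ℝ) X := hasFDerivAt_snd.sub_const t₀
  have hp := ((hA.hess _ hX).comp X hfst).add (hsnd.smul ((hB.hess _ hX).comp X hfst))
  have hv := ((hA.grad _ hX).comp X hfst).add (hsnd.mul ((hB.grad _ hX).comp X hfst))
  have hall := hp.prodMk (hv.sub (hp.inner ℝ (hfst.sub_const w)))
  refine hall.congr_fderiv ?_
  refine ContinuousLinearMap.ext fun ξ => Prod.ext ?_ ?_
  · simp [legendreDeriv, add_assoc]
  · simp [legendreDeriv]
    simp only [inner_add_left, real_inner_smul_left, inner_sub_right]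
    rw [real_inner_comm X.1, real_inner_comm w, real_inner_comm X.1, real_inner_comm w,
      real_inner_comm X.1, real_inner_comm w]
    ring

/-- The set of points where the function `A + (t - t₀) B` can be touched from above. -/
def contactSet {n : ℕ} (A B : Space n → ℝ) (HA HB : Space n → Space n →L[ℝ] Space n)
    (w : Space n) (R t₀ t₁ : ℝ) : Set (Space n × ℝ) :=
  {X ∈ closedBall w R ×ˢ Icc t₀ t₁ | 0 ≤ B X.1 ∧ 0 ≤ A X.1 + (X.2 - t₀) * B X.1 ∧
    ∀ ξ, ⟪(HA X.1 + (X.2 - t₀) • HB X.1) ξ, ξ⟫ ≤ 0}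

section

variable {n : ℕ} {A B : Space n → ℝ} {GA GB : Space n → Space n}
    {HA HB : Space n → Space n →L[ℝ] Space n} {U : Set (Space n)} {w : Space n} {R t₀ t₁ : ℝ}

theorem HasHessianOn.continuousOn {n : ℕ} {f : Space n → ℝ} {G : Space n → Space n}
    {H : Space n → Space n →L[ℝ] Space n} {U : Set (Space n)} (hf : HasHessianOn f G H U) :
    ContinuousOn f U := fun x hx => (hf.grad x hx).continuousAt.continuousWithinAt

theorem measurableSet_contactSet (hA : HasHessianOn A GA HA U) (hB : HasHessianOn B GB HB U)
    (hKU : closedBall w R ⊆ U) : MeasurableSet (contactSet A B HA HB w R t₀ t₁) := by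
  have hK : IsClosed (closedBall w R ×ˢ Icc t₀ t₁) := isClosed_closedBall.prod isClosed_Icc
  have hmaps : MapsTo Prod.fst (closedBall w R ×ˢ Icc t₀ t₁) U := fun X hX => hKU hX.1
  have hAc := hA.continuousOn.comp continuousOn_fst hmaps
  have hBc := hB.continuousOn.comp continuousOn_fst hmaps
  have hHA := hA.cont.comp continuousOn_fst hmaps
  have hHB := hB.cont.comp continuousOn_fst hmaps
  have hs : ContinuousOn (fun X : Space n × ℝ => X.2 - t₀) (closedBall w R ×ˢ Icc t₀ t₁) := by
    fun_prop
  have h1 := hBc.preimage_isClosed_of_isClosed hK (isClosed_Ici (a := (0 : ℝ)))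
  have h2 := (hAc.add (hs.mul hBc)).preimage_isClosed_of_isClosed hK (isClosed_Ici (a := (0 : ℝ)))
  have h3 : ∀ ξ : Space n, IsClosed ((closedBall w R ×ˢ Icc t₀ t₁) ∩
      (fun X : Space n × ℝ => ⟪(HA X.1 + (X.2 - t₀) • HB X.1) ξ, ξ⟫) ⁻¹' Iic 0) := fun ξ =>
    (((hHA.add (hs.smul hHB)).clm_apply continuousOn_const).inner
      continuousOn_const).preimage_isClosed_of_isClosed hK isClosed_Iic
  have : contactSet A B HA HB w R t₀ t₁ =
      ((closedBall w R ×ˢ Icc t₀ t₁) ∩ (B ∘ Prod.fst) ⁻¹' Ici 0) ∩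
      ((closedBall w R ×ˢ Icc t₀ t₁) ∩
        (fun X => (A ∘ Prod.fst) X + (X.2 - t₀) * (B ∘ Prod.fst) X) ⁻¹' Ici 0) ∩
      ⋂ ξ : Space n, ((closedBall w R ×ˢ Icc t₀ t₁) ∩
      (fun X : Space n × ℝ => ⟪(HA X.1 + (X.2 - t₀) • HB X.1) ξ, ξ⟫) ⁻¹' Iic 0) := by
    ext X
    simp only [contactSet, mem_ofPred_eq, mem_inter_iff, mem_preimage, mem_Ici, mem_iInter, mem_Iic,
      Function.comp]
    constructor
    · rintro ⟨h, h4, h5, h6⟩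
      exact ⟨⟨⟨h, h4⟩, h, h5⟩, fun ξ => ⟨h, h6 ξ⟩⟩
    · rintro ⟨⟨⟨h, h4⟩, _, h5⟩, h6⟩
      exact ⟨h, h4, h5, fun ξ => (h6 ξ).2⟩
  rw [this]
  exact ((h1.inter h2).inter (isClosed_iInter h3)).measurableSet

/-- Each q = (p, k) is a plane k + ⟨p, x - w⟩ that lies above V initially and on the lateral
boundary but not at the final time. At the first time V reaches it, contact is interior, so ∇V = p
and D²V ≤ 0. The condition k ≥ R‖p‖ makes the contact value nonnegative. -/
theorem exists_contact (hU : IsOpen U) (hA : HasHessianOn A GA HA U) (hB : HasHessianOn B GB HB U)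
    (hKU : closedBall w R ⊆ U) (ht : t₀ ≤ t₁) {q : Space n × ℝ} (hq : R * ‖q.1‖ ≤ q.2)
    (h0 : ∀ x ∈ closedBall w R, A x - ⟪q.1, x - w⟫ < q.2)
    (h1 : ∃ x ∈ closedBall w R, q.2 ≤ A x + (t₁ - t₀) * B x - ⟪q.1, x - w⟫)
    (hlat : ∀ x ∈ sphere w R, ∀ t ∈ Icc t₀ t₁, A x + (t - t₀) * B x - ⟪q.1, x - w⟫ < q.2) :
    ∃ X ∈ contactSet A B HA HB w R t₀ t₁, (GA X.1 + (X.2 - t₀) • GB X.1,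
      A X.1 + (X.2 - t₀) * B X.1 - ⟪GA X.1 + (X.2 - t₀) • GB X.1, X.1 - w⟫) = q := by
  set φ : Space n × ℝ → ℝ := fun X => A X.1 + (X.2 - t₀) * B X.1 - ⟪q.1, X.1 - w⟫ with hφ
  have hK : IsCompact (closedBall w R ×ˢ Icc t₀ t₁) := (isCompact_closedBall w R).prod isCompact_Icc
  have hmaps : MapsTo Prod.fst (closedBall w R ×ˢ Icc t₀ t₁) U := fun X hX => hKU hX.1
  have hφc : ContinuousOn φ (closedBall w R ×ˢ Icc t₀ t₁) := by
    have hAc := hA.continuousOn.comp continuousOn_fst hmaps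
    have hBc := hB.continuousOn.comp continuousOn_fst hmaps
    have hs : ContinuousOn (fun X : Space n × ℝ => X.2 - t₀) (closedBall w R ×ˢ Icc t₀ t₁) := by
      fun_prop
    have hi : ContinuousOn (fun X : Space n × ℝ => ⟪q.1, X.1 - w⟫)
      (closedBall w R ×ˢ Icc t₀ t₁) := by fun_prop
    exact (hAc.add (hs.mul hBc)).sub hi
  have hC : IsCompact ((closedBall w R ×ˢ Icc t₀ t₁) ∩ φ ⁻¹' Ici q.2) :=
    hK.of_isClosed_subset (hφc.preimage_isClosed_of_isClosed hK.isClosed isClosed_Ici)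
      inter_subset_left
  obtain ⟨x₁, hx₁, hx₁'⟩ := h1
  -- The first contact time minimises the time coordinate on the compact set where V lies on or
  -- above the plane.
  obtain ⟨⟨x, t⟩, ⟨⟨hxK, htI⟩, hxt⟩, hmin⟩ := hC.exists_isMinOn
    ⟨(x₁, t₁), ⟨hx₁, right_mem_Icc.2 ht⟩, hx₁'⟩ (continuousOn_snd (s := _))
  simp only at hxK htI
  rw [mem_preimage, mem_Ici] at hxt
  have hbefore : ∀ z ∈ closedBall w R, ∀ τ ∈ Ico t₀ t, φ (z, τ) < q.2 := by
    intro z hz τ hτ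
    by_contra! hcon
    have := hmin (show (z, τ) ∈ _ from ⟨⟨hz, hτ.1, hτ.2.le.trans htI.2⟩, hcon⟩)
    exact absurd hτ.2 (not_lt.2 this)
  have htpos : t₀ < t := by
    refine lt_of_le_of_ne htI.1 fun h => ?_
    subst h
    have := h0 x hxK
    simp only [hφ, sub_self, zero_mul, add_zero] at hxt
    linarith
  have hle : ∀ z ∈ closedBall w R, ∀ τ ∈ Icc t₀ t, φ (z, τ) ≤ q.2 := by
    intro z hz τ hτ
    rcases eq_or_lt_of_le hτ.2 with rfl | h
    · have hlim : Tendsto (fun s : ℝ => φ (z, s)) (𝓝[<] τ) (𝓝 (φ (z, τ))) := by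
        have : Continuous fun s : ℝ => φ (z, s) := by simp only [hφ]; fun_prop
        exact this.continuousAt.continuousWithinAt
      refine le_of_tendsto hlim ?_
      filter_upwards [Ioo_mem_nhdsLT htpos] with s hs
      exact (hbefore z hz s ⟨hs.1.le, hs.2⟩).le
    · exact (hbefore z hz τ ⟨hτ.1, h⟩).le
  have heq : φ (x, t) = q.2 := le_antisymm (hle x hxK t (right_mem_Icc.2 htI.1)) hxt
  have hxball : x ∈ ball w R := by
    refine mem_ball.2 (lt_of_le_of_ne (mem_closedBall.1 hxK) fun h => ?_)
    exact absurd (hlat x h t htI) (not_lt.2 hxt)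
  have hxU := hKU hxK
  have hV := (hA.combo hB 1 (t - t₀))
  have hmax : IsLocalMax (fun z => 1 * A z + (t - t₀) * B z - ⟪q.1, z - w⟫) x := by
    filter_upwards [isOpen_ball.mem_nhds hxball] with z hz
    have h2 := hle z (ball_subset_closedBall hz) t (right_mem_Icc.2 htI.1)
    rw [← heq] at h2
    simpa [hφ] using h2
  have hgrad : ∀ᶠ z in 𝓝 x, HasFDerivAt (fun z => 1 * A z + (t - t₀) * B z - ⟪q.1, z - w⟫)
      (innerSL ℝ ((1 : ℝ) • GA z + (t - t₀) • GB z - q.1)) z := by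
    filter_upwards [hU.mem_nhds hxU] with z hz
    have h3 : HasFDerivAt (fun z => ⟪q.1, z - w⟫) (innerSL ℝ q.1) z :=
      (innerSL ℝ q.1).hasFDerivAt.comp z ((hasFDerivAt_id z).sub_const w)
    refine ((hV.grad z hz).sub h3).congr_fderiv ?_
    rw [map_sub]
  obtain ⟨hG0, hH⟩ := hessian_nonpos_of_isLocalMax hgrad ((hV.hess x hxU).sub_const q.1) hmax
  rw [one_smul, sub_eq_zero] at hG0
  have hval : A x + (t - t₀) * B x - ⟪q.1, x - w⟫ = q.2 := heq
  refine ⟨(x, t), ⟨⟨hxK, htI⟩, ?_, ?_, ?_⟩, ?_⟩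
  -- V is affine in t and does not exceed its contact value at t₀, so its slope B is nonnegative.
  · have h4 := hle x hxK t₀ ⟨le_rfl, htI.1⟩
    simp only [hφ, sub_self, zero_mul, add_zero] at h4
    have : 0 ≤ (t - t₀) * B x := by linarith
    exact nonneg_of_mul_nonneg_right this (sub_pos.2 htpos)
  · have h5 : |⟪q.1, x - w⟫| ≤ ‖q.1‖ * R := (abs_real_inner_le_norm _ _).trans (by
      gcongr; simpa [dist_eq_norm] using hxK)
    have := neg_abs_le ⟪q.1, x - w⟫
    simp only
    linarith [mul_comm R ‖q.1‖]
  · intro ξ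
    simpa using hH ξ
  · refine Prod.ext ?_ ?_
    · exact hG0
    · simp only [hG0, hval]

/-- The area estimate for the parabolic Legendre map. -/
theorem volume_le_lintegral_contactSet (hU : IsOpen U) (hA : HasHessianOn A GA HA U)
    (hB : HasHessianOn B GB HB U) (hKU : closedBall w R ⊆ U) (ht : t₀ ≤ t₁)
    {P : Set (Space n × ℝ)} (hP : ∀ q ∈ P, R * ‖q.1‖ ≤ q.2 ∧
      (∀ x ∈ closedBall w R, A x - ⟪q.1, x - w⟫ < q.2) ∧
      (∃ x ∈ closedBall w R, q.2 ≤ A x + (t₁ - t₀) * B x - ⟪q.1, x - w⟫) ∧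
      ∀ x ∈ sphere w R, ∀ t ∈ Icc t₀ t₁, A x + (t - t₀) * B x - ⟪q.1, x - w⟫ < q.2) :
    volume P ≤ ∫⁻ X in contactSet A B HA HB w R t₀ t₁,
      ENNReal.ofReal |(hessianMatrix (HA X.1 + (X.2 - t₀) • HB X.1)).det * B X.1| := by
  refine (measure_mono (t := (fun Y : Space n × ℝ => (GA Y.1 + (Y.2 - t₀) • GB Y.1,
      A Y.1 + (Y.2 - t₀) * B Y.1 - ⟪GA Y.1 + (Y.2 - t₀) • GB Y.1, Y.1 - w⟫)) ''
      contactSet A B HA HB w R t₀ t₁) fun q hq => ?_).trans ?_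
  · obtain ⟨h1, h2, h3, h4⟩ := hP q hq
    obtain ⟨X, hX, hXq⟩ := exists_contact hU hA hB hKU ht h1 h2 h3 h4
    exact ⟨X, hX, hXq⟩
  · have : (volume : Measure (Space n × ℝ)).IsAddHaarMeasure :=
      Measure.prod.instIsAddHaarMeasure _ _
    refine (addHaar_image_le_lintegral_abs_det_fderiv volume
      (measurableSet_contactSet hA hB hKU) fun X hX =>
        (hasFDerivAt_legendre hA hB w t₀ (hKU hX.1.1)).hasFDerivWithinAt).trans_eq ?_
    simp only [det_legendreDeriv]

end

/-! ### The parabolic Aleksandrov–Bakelman–Pucci–Krylov–Tso estimate -/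

/-- Both b and -ω tr(aM) are nonnegative and their sum is at most f, so each is at most f.
Ellipticity turns the second bound into one for tr(-M), hence for the determinant. -/
theorem abs_det_mul_le {n : ℕ} {ν ω f b : ℝ} {a M : Matrix (Fin n) (Fin n) ℝ} (hν : 0 < ν)
    (hω : 0 < ω) (ha : ∀ ξ : Space n, ν * ‖ξ‖ ^ 2 ≤ ∑ i, ∑ j, a i j * ξ i * ξ j)
    (hM : (-M).PosSemidef) (hb : 0 ≤ b) (hf : b - ω * ∑ i, ∑ j, a i j * M i j ≤ f) :
    |M.det * b| ≤ f * (f / (ν * ω)) ^ n := by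
  have htr := mul_trace_le_of_posSemidef ha hM
  have hsum : ∑ i, ∑ j, a i j * (-M) i j = -∑ i, ∑ j, a i j * M i j := by
    simp [Finset.sum_neg_distrib]
  rw [hsum] at htr
  have htr0 : 0 ≤ (-M).trace := hM.trace_nonneg
  have h1 : ω * (ν * (-M).trace) ≤ ω * -∑ i, ∑ j, a i j * M i j := by gcongr
  have h2 : 0 ≤ ω * (ν * (-M).trace) := by positivity
  have hbf : b ≤ f := by linarith
  have htf : (-M).trace ≤ f / (ν * ω) := by
    rw [le_div_iff₀ (by positivity)]; nlinarith
  have hdet : |M.det| = (-M).det := by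
    rw [← abs_of_nonneg hM.det_nonneg, Matrix.det_neg, abs_mul, abs_pow]
    simp
  rw [abs_mul, hdet, abs_of_nonneg hb, mul_comm]
  have hd := det_le_trace_pow hM
  have : (-M).det ≤ (f / (ν * ω)) ^ n := hd.trans (by gcongr)
  exact mul_le_mul hbf this hM.det_nonneg (hb.trans hbf)

/-! ### Interpolation in time and the estimate on a fine mesh -/

section

variable {n : ℕ} {U : Set (Space n)} {w : Space n} {R s₀ s₁ : ℝ}

/-- The area estimate is applied to the function affine in time with end slices v₀ and v₁. It thus
needs only spatial Hessians of two slices and the difference quotient in time. The density bound may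
fail on a null set of (x, t). -/
theorem volume_le_of_slab (hU : IsOpen U) (hKU : closedBall w R ⊆ U) (hs : s₀ < s₁)
    {v₀ v₁ : Space n → ℝ} {G₀ G₁ : Space n → Space n} {H₀ H₁ : Space n → Space n →L[ℝ] Space n}
    (h₀ : HasHessianOn v₀ G₀ H₀ U) (h₁ : HasHessianOn v₁ G₁ H₁ U) {P : Set (Space n × ℝ)}
    (hlat₀ : ∀ x ∈ sphere w R, v₀ x ≤ 0) (hlat₁ : ∀ x ∈ sphere w R, v₁ x ≤ 0)
    (hP : ∀ q ∈ P, R * ‖q.1‖ < q.2 ∧ (∀ x ∈ closedBall w R, v₀ x - ⟪q.1, x - w⟫ < q.2) ∧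
      ∃ x ∈ closedBall w R, q.2 ≤ v₁ x - ⟪q.1, x - w⟫)
    {F : Space n → ℝ} (hF : AEMeasurable F (volume.restrict (closedBall w R)))
    (hb : ∀ᵐ X ∂(volume.restrict (closedBall w R ×ˢ Icc s₀ s₁)),
      ∀ θ : ℝ, θ = (X.2 - s₀) / (s₁ - s₀) → 0 ≤ (v₁ X.1 - v₀ X.1) / (s₁ - s₀) →
      0 ≤ (1 - θ) * v₀ X.1 + θ * v₁ X.1 →
      (-hessianMatrix ((1 - θ) • H₀ X.1 + θ • H₁ X.1)).PosSemidef →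
      |(hessianMatrix ((1 - θ) • H₀ X.1 + θ • H₁ X.1)).det * ((v₁ X.1 - v₀ X.1) / (s₁ - s₀))| ≤
        F X.1) :
    volume P ≤ ENNReal.ofReal (s₁ - s₀) * ∫⁻ x in closedBall w R, ENNReal.ofReal (F x) := by
  set δ := s₁ - s₀ with hδ
  have hδ0 : 0 < δ := sub_pos.2 hs
  have hB := h₁.combo h₀ δ⁻¹ (-δ⁻¹)
  have hBx : ∀ x, δ⁻¹ * v₁ x + -δ⁻¹ * v₀ x = (v₁ x - v₀ x) / δ := fun x => by
    field_simp; ring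
  have hVx : ∀ x t, v₀ x + (t - s₀) * (δ⁻¹ * v₁ x + -δ⁻¹ * v₀ x) =
      (1 - (t - s₀) / δ) * v₀ x + (t - s₀) / δ * v₁ x := fun x t => by
    field_simp; ring
  have hHx : ∀ x t, H₀ x + (t - s₀) • (δ⁻¹ • H₁ x + -δ⁻¹ • H₀ x) =
      (1 - (t - s₀) / δ) • H₀ x + ((t - s₀) / δ) • H₁ x := fun x t => by
    rw [div_eq_mul_inv]; module
  have hinner : ∀ q : Space n × ℝ, ∀ x ∈ sphere w R, -(R * ‖q.1‖) ≤ ⟪q.1, x - w⟫ := by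
    intro q x hx
    have h5 : |⟪q.1, x - w⟫| ≤ ‖q.1‖ * R := (abs_real_inner_le_norm _ _).trans (by
      gcongr; rw [← dist_eq_norm]; exact le_of_eq hx)
    linarith [neg_abs_le ⟪q.1, x - w⟫]
  -- The strict inequality R‖p‖ < q.2 keeps the plane strictly positive on the sphere, where both
  -- slices, hence their interpolation, are nonpositive.
  refine (volume_le_lintegral_contactSet hU h₀ hB hKU hs.le (P := P) fun q hq => ?_).trans ?_
  · obtain ⟨h1, h2, x, hx, h3⟩ := hP q hq
    refine ⟨h1.le, h2, ⟨x, hx, ?_⟩, fun x hx t ht => ?_⟩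
    · rw [hVx, ← hδ, div_self hδ0.ne']
      simpa using h3
    · rw [hVx]
      have h4 : 0 ≤ (t - s₀) / δ := div_nonneg (sub_nonneg.2 ht.1) hδ0.le
      have h5 : (t - s₀) / δ ≤ 1 := by rw [div_le_one hδ0]; linarith [ht.2]
      have h6 := mul_nonneg (sub_nonneg.2 h5) (neg_nonneg.2 (hlat₀ x hx))
      have h7 := mul_nonneg h4 (neg_nonneg.2 (hlat₁ x hx))
      have h8 := hinner q x hx
      linarith
  · set S := contactSet v₀ (fun x => δ⁻¹ * v₁ x + -δ⁻¹ * v₀ x) H₀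
        (fun x => δ⁻¹ • H₁ x + -δ⁻¹ • H₀ x) w R s₀ s₁ with hS
    have hsub : S ⊆ closedBall w R ×ˢ Icc s₀ s₁ := fun X hX => hX.1
    calc _ ≤ ∫⁻ X in S, ENNReal.ofReal (F X.1) := by
          refine lintegral_mono_ae ?_
          filter_upwards [ae_restrict_of_ae_restrict_of_subset hsub hb,
            ae_restrict_mem (measurableSet_contactSet h₀ hB hKU)] with X hX hXS
          obtain ⟨hXK, hX1, hX2, hX3⟩ := hXS
          beta_reduce at hX1 hX2 hX3
          rw [hBx] at hX1
          rw [hVx] at hX2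
          have hsymm : ∀ ξ η, ⟪(H₀ X.1 + (X.2 - s₀) • (δ⁻¹ • H₁ X.1 + -δ⁻¹ • H₀ X.1)) ξ, η⟫ =
              ⟪(H₀ X.1 + (X.2 - s₀) • (δ⁻¹ • H₁ X.1 + -δ⁻¹ • H₀ X.1)) η, ξ⟫ := by
            rw [hHx]
            have hc := h₀.combo h₁ (1 - (X.2 - s₀) / δ) ((X.2 - s₀) / δ)
            exact inner_hessian_symm
              (eventually_of_mem (hU.mem_nhds (hKU hXK.1)) hc.grad) (hc.hess _ (hKU hXK.1))
          have hpsd := posSemidef_neg_hessianMatrix hsymm hX3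
          simp only [hHx, hBx] at hpsd ⊢
          exact ENNReal.ofReal_le_ofReal (hX _ rfl hX1 hX2 hpsd)
      _ ≤ ∫⁻ X in closedBall w R ×ˢ Icc s₀ s₁, ENNReal.ofReal (F X.1) := lintegral_mono_set hsub
      _ = _ := by
          rw [Measure.volume_eq_prod, ← Measure.prod_restrict,
            lintegral_prod (fun X : Space n × ℝ => ENNReal.ofReal (F X.1))
              (hF.ennreal_ofReal.comp_fst)]
          simp only [lintegral_const, Measure.restrict_apply_univ, Real.volume_Icc]
          rw [lintegral_mul_const'' _ hF.ennreal_ofReal, mul_comm]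

theorem exists_mesh {t₀ t₁ : ℝ} {v vt : Space n → ℝ → ℝ}
    {H : Space n → ℝ → Space n →L[ℝ] Space n}
    (hvc : ContinuousOn (fun X : Space n × ℝ => v X.1 X.2) (closedBall w R ×ˢ Icc t₀ t₁))
    (hvtc : ContinuousOn (fun X : Space n × ℝ => vt X.1 X.2) (closedBall w R ×ˢ Icc t₀ t₁))
    (hHc : ContinuousOn (fun X : Space n × ℝ => H X.1 X.2) (closedBall w R ×ˢ Icc t₀ t₁))
    {η : ℝ} (hη : 0 < η) :
    ∃ δ > 0, ∀ x ∈ closedBall w R, ∀ t ∈ Icc t₀ t₁, ∀ t' ∈ Icc t₀ t₁, |t - t'| < δ →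
      |v x t - v x t'| < η ∧ |vt x t - vt x t'| < η ∧ ‖H x t - H x t'‖ < η := by
  have hK : IsCompact (closedBall w R ×ˢ Icc t₀ t₁) := (isCompact_closedBall w R).prod isCompact_Icc
  obtain ⟨δ, hδ, h⟩ := Metric.uniformContinuousOn_iff.1
    (hK.uniformContinuousOn_of_continuous (hvc.prodMk (hvtc.prodMk hHc))) η hη
  refine ⟨δ, hδ, fun x hx t ht t' ht' htt => ?_⟩
  have := h (x, t) ⟨hx, ht⟩ (x, t') ⟨hx, ht'⟩ (by
    rw [Prod.dist_eq, dist_self, Real.dist_eq]; exact max_lt hδ htt)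
  simpa [Prod.dist_eq, Real.dist_eq, dist_eq_norm] using this

theorem abs_hessianMatrix_le {n : ℕ} (H : Space n →L[ℝ] Space n) (i j : Fin n) :
    |hessianMatrix H i j| ≤ ‖H‖ := by
  have h1 : |hessianMatrix H i j| ≤ ‖H (EuclideanSpace.single i 1)‖ := by
    exact PiLp.norm_apply_le (H (EuclideanSpace.single i 1)) j
  refine h1.trans ((H.le_opNorm _).trans_eq ?_)
  simp

end

theorem abs_sum_mul_hessianMatrix_sub_le {n : ℕ} {ν η : ℝ} {a : Matrix (Fin n) (Fin n) ℝ}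
    (ha : ∀ i j, |a i j| ≤ ν⁻¹) {H M : Space n →L[ℝ] Space n} (hν : 0 < ν) (h : ‖M - H‖ ≤ η) :
    |∑ i, ∑ j, a i j * hessianMatrix M i j - ∑ i, ∑ j, a i j * hessianMatrix H i j| ≤
      (n : ℝ) ^ 2 * ν⁻¹ * η := by
  simp only [← Finset.sum_sub_distrib]
  calc _ ≤ ∑ i, |∑ j, (a i j * hessianMatrix M i j - a i j * hessianMatrix H i j)| :=
        Finset.abs_sum_le_sum_abs _ _
    _ ≤ ∑ _i : Fin n, ∑ _j : Fin n, ν⁻¹ * η := by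
        refine Finset.sum_le_sum fun i _ => (Finset.abs_sum_le_sum_abs _ _).trans
          (Finset.sum_le_sum fun j _ => ?_)
        have h1 : hessianMatrix M i j - hessianMatrix H i j = hessianMatrix (M - H) i j := by
          simp [hessianMatrix]
        rw [← mul_sub, h1, abs_mul]
        exact mul_le_mul (ha i j) ((abs_hessianMatrix_le _ _ _).trans h) (abs_nonneg _)
          (inv_nonneg.2 hν.le)
    _ = _ := by simp; ring

section

variable {n : ℕ} {U : Set (Space n)} {w : Space n} {R t₀ t₁ : ℝ}

/-- Every plane in the cone is first reached in one of the N slabs of length τ, and the slab bounds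
add up to the factor t₁ - t₀ whatever the mesh. The differential inequality is needed only where v >
-η₀, because contact occurs where the interpolated function is nonnegative. -/
theorem volume_le_of_subsolution_aux (hU : IsOpen U) (hR : 0 < R) (hKU : closedBall w R ⊆ U)
    (ht : t₀ < t₁) {v vt : Space n → ℝ → ℝ} {G : Space n → ℝ → Space n}
    {H : Space n → ℝ → Space n →L[ℝ] Space n}
    (hv : ∀ t ∈ Icc t₀ t₁, HasHessianOn (fun x => v x t) (fun x => G x t) (fun x => H x t) U)
    (hvt : ∀ x ∈ closedBall w R, ∀ t ∈ Icc t₀ t₁, HasDerivAt (v x) (vt x t) t)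
    (hvc : ContinuousOn (fun X : Space n × ℝ => v X.1 X.2) (closedBall w R ×ˢ Icc t₀ t₁))
    (hvtc : ContinuousOn (fun X : Space n × ℝ => vt X.1 X.2) (closedBall w R ×ˢ Icc t₀ t₁))
    (hHc : ContinuousOn (fun X : Space n × ℝ => H X.1 X.2) (closedBall w R ×ˢ Icc t₀ t₁))
    (hlat : ∀ x ∈ sphere w R, ∀ t ∈ Icc t₀ t₁, v x t ≤ 0) (hinit : ∀ x ∈ closedBall w R, v x t₀ ≤ 0)
    {ν η₀ η M : ℝ} (hν : 0 < ν) {ω f : Space n → ℝ} (hω : ∀ᵐ x, 0 < ω x)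
    (hωm : AEMeasurable ω (volume.restrict (closedBall w R)))
    (hfm : AEMeasurable f (volume.restrict (closedBall w R)))
    {a : Space n × ℝ → Matrix (Fin n) (Fin n) ℝ}
    (hlow : ∀ X ∈ closedBall w R ×ˢ Icc t₀ t₁, ∀ ξ : Space n,
      ν * ‖ξ‖ ^ 2 ≤ ∑ i, ∑ j, a X i j * ξ i * ξ j)
    (hup : ∀ X ∈ closedBall w R ×ˢ Icc t₀ t₁, ∀ i j, |a X i j| ≤ ν⁻¹)
    (hpde : ∀ᵐ X ∂(volume.restrict (closedBall w R ×ˢ Icc t₀ t₁)), -η₀ < v X.1 X.2 →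
      vt X.1 X.2 - ω X.1 * ∑ i, ∑ j, a X i j * hessianMatrix (H X.1 X.2) i j ≤ f X.1)
    (hM : ∃ x ∈ closedBall w R, M ≤ v x t₁) (hη : 0 < η) (hη₀ : η ≤ η₀) :
    volume {q : Space n × ℝ | 2 * R * ‖q.1‖ < q.2 ∧ q.2 < M / 2} ≤
      ENNReal.ofReal (t₁ - t₀) * ∫⁻ x in closedBall w R, ENNReal.ofReal
        ((f x + η + ω x * ((n : ℝ) ^ 2 * ν⁻¹ * η)) *
          ((f x + η + ω x * ((n : ℝ) ^ 2 * ν⁻¹ * η)) / (ν * ω x)) ^ n) := by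
  -- The source is enlarged by η for the error in the time slope and by ω n² ν⁻¹ η for the error in
  -- the Hessian.
  set F : Space n → ℝ := fun x => (f x + η + ω x * ((n : ℝ) ^ 2 * ν⁻¹ * η)) *
          ((f x + η + ω x * ((n : ℝ) ^ 2 * ν⁻¹ * η)) / (ν * ω x)) ^ n with hF
  have hFm : AEMeasurable F (volume.restrict (closedBall w R)) := by
    have h1 : AEMeasurable (fun x => f x + η + ω x * ((n : ℝ) ^ 2 * ν⁻¹ * η))
      (volume.restrict (closedBall w R)) := (hfm.add_const η).add (hωm.mul_const _)
    exact h1.mul ((h1.div (hωm.const_mul ν)).pow_const n)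
  obtain ⟨δ, hδ, hmesh⟩ := exists_mesh hvc hvtc hHc hη
  obtain ⟨N, hN⟩ := exists_nat_gt ((t₁ - t₀) / δ)
  have hN0 : (0 : ℝ) < N := lt_of_le_of_lt (div_nonneg (sub_nonneg.2 ht.le) hδ.le) hN
  set τ : ℝ := (t₁ - t₀) / N with hτ
  have hτ0 : 0 < τ := div_pos (sub_pos.2 ht) hN0
  have hτδ : τ < δ := by
    rw [hτ, div_lt_iff₀ hN0]; rw [div_lt_iff₀ hδ] at hN; linarith
  set s : ℕ → ℝ := fun k => t₀ + k * τ with hs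
  have hs1 : ∀ k, s (k + 1) - s k = τ := fun k => by simp only [hs]; push_cast; ring
  have hsmem : ∀ k ≤ N, s k ∈ Icc t₀ t₁ := by
    intro k hk
    have h1 : (k : ℝ) * τ ≤ N * τ := by gcongr
    have h2 : (N : ℝ) * τ = t₁ - t₀ := by rw [hτ]; field_simp
    have h3 : 0 ≤ (k : ℝ) * τ := by positivity
    exact ⟨by simp only [hs]; linarith, by simp only [hs]; linarith⟩
  have hs0 : s 0 = t₀ := by simp [hs]
  have hsN : s N = t₁ := by simp only [hs, hτ]; field_simp; ring
  have hinner : ∀ (p : Space n), ∀ x ∈ closedBall w R, |⟪p, x - w⟫| ≤ R * ‖p‖ := by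
    intro p x hx
    rw [mul_comm]
    refine (abs_real_inner_le_norm _ _).trans ?_
    gcongr
    simpa [dist_eq_norm] using hx
  set A : Set (Space n × ℝ) := {q | 2 * R * ‖q.1‖ < q.2 ∧ q.2 < M / 2} with hA
  set P : ℕ → Set (Space n × ℝ) := fun k => {q ∈ A |
    (∀ x ∈ closedBall w R, v x (s k) - ⟪q.1, x - w⟫ < q.2) ∧
    ∃ x ∈ closedBall w R, q.2 ≤ v x (s (k + 1)) - ⟪q.1, x - w⟫} with hP
  have hcover : A ⊆ ⋃ k ∈ Finset.range N, P k := by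
    intro q hq
    have hq1 : 2 * R * ‖q.1‖ < q.2 := hq.1
    have hq2 : q.2 < M / 2 := hq.2
    have hRq : 0 ≤ R * ‖q.1‖ := by positivity
    by_contra hcon
    simp only [mem_iUnion, Finset.mem_range, not_exists] at hcon
    have hall : ∀ k ≤ N, ∀ x ∈ closedBall w R, v x (s k) - ⟪q.1, x - w⟫ < q.2 := by
      intro k
      induction k with
      | zero =>
        intro _ x hx
        rw [hs0]
        have h1 := hinit x hx
        have h2 := (abs_le.1 (hinner q.1 x hx)).1
        linarith
      | succ k ih =>
        intro hk x hx
        by_contra! hge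
        exact hcon k (by omega) ⟨hq, ih (by omega), x, hx, hge⟩
    obtain ⟨x, hx, hMx⟩ := hM
    have h1 := hall N le_rfl x hx
    rw [hsN] at h1
    have h2 := (abs_le.1 (hinner q.1 x hx)).2
    linarith
  have hPk : ∀ k ∈ Finset.range N, volume (P k) ≤
      ENNReal.ofReal τ * ∫⁻ x in closedBall w R, ENNReal.ofReal (F x) := by
    intro k hk
    have hkN : k < N := Finset.mem_range.1 hk
    have hk0 := hsmem k hkN.le
    have hk1 := hsmem (k + 1) hkN
    have hlt : s k < s (k + 1) := by linarith [hs1 k]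
    have hsub : Icc (s k) (s (k + 1)) ⊆ Icc t₀ t₁ := Icc_subset_Icc hk0.1 hk1.2
    rw [← hs1 k]
    refine volume_le_of_slab hU hKU hlt (hv _ hk0) (hv _ hk1) (fun x hx => hlat x hx _ hk0)
      (fun x hx => hlat x hx _ hk1) (fun q hq => ⟨?_, hq.2.1, hq.2.2⟩) hFm ?_
    · have hRq : 0 ≤ R * ‖q.1‖ := by positivity
      have hq1 : 2 * R * ‖q.1‖ < q.2 := hq.1.1
      linarith
    · have hωX : ∀ᵐ X : Space n × ℝ ∂(volume.restrict (closedBall w R ×ˢ Icc (s k) (s (k + 1)))),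
          0 < ω X.1 :=
        ae_restrict_of_ae (Measure.quasiMeasurePreserving_fst.ae hω)
      filter_upwards [hωX, ae_restrict_of_ae_restrict_of_subset
        (prod_mono_right hsub) hpde, ae_restrict_mem
        (measurableSet_closedBall.prod measurableSet_Icc)] with ⟨x, t⟩ hωx hpx hXmem θ hθ hB hV hpsd
      simp only at hωx hpx hθ hB hV hpsd ⊢
      obtain ⟨hx, htk⟩ := hXmem
      simp only at hx htk
      have htI := hsub htk
      have hθ0 : 0 ≤ θ := by
        rw [hθ]; exact div_nonneg (sub_nonneg.2 htk.1) (sub_nonneg.2 hlt.le)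
      have hθ1 : θ ≤ 1 := by
        rw [hθ, div_le_one (sub_pos.2 hlt)]; linarith [htk.2]
      have hm0 := hmesh x hx _ hk0 t htI (by
        rw [abs_sub_comm, abs_of_nonneg (sub_nonneg.2 htk.1)]; linarith [htk.2, hs1 k])
      have hm1 := hmesh x hx _ hk1 t htI (by
        rw [abs_of_nonneg (sub_nonneg.2 htk.2)]; linarith [htk.1, hs1 k])
      -- The slope of the interpolation is a value of vt inside the slab, hence within η of vt at t.
      obtain ⟨c, hc, hcs⟩ := exists_hasDerivAt_eq_slope (v x) (vt x) hlt
        (fun t' ht' => (hvt x hx t' (hsub ht')).continuousAt.continuousWithinAt)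
        (fun t' ht' => hvt x hx t' (hsub (Ioo_subset_Icc_self ht')))
      have hmc := (hmesh x hx c (hsub (Ioo_subset_Icc_self hc)) t htI (by
        rw [abs_lt]; constructor <;> linarith [hc.1, hc.2, htk.1, htk.2, hs1 k])).2.1
      rw [hcs] at hmc
      -- A convex combination of slice values, each less than v x t + η, is nonnegative. The split
      -- on θ keeps the inequality strict.
      have hvx : -η₀ < v x t := by
        have h1 := (abs_lt.1 hm0.1).2
        have h2 := (abs_lt.1 hm1.1).2
        have h3 := mul_nonneg (sub_nonneg.2 hθ1) (sub_nonneg.2 h1.le)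
        have h4 := mul_nonneg hθ0 (sub_nonneg.2 h2.le)
        rcases hθ0.eq_or_lt with h5 | h5
        · rw [← h5] at hV; linarith
        · have h4 := mul_pos h5 (sub_pos.2 h2)
          linarith
      have hpx' := hpx hvx
      have hH : ‖((1 - θ) • H x (s k) + θ • H x (s (k + 1))) - H x t‖ ≤ η := by
        have h1 : ((1 - θ) • H x (s k) + θ • H x (s (k + 1))) - H x t =
          (1 - θ) • (H x (s k) - H x t) + θ • (H x (s (k + 1)) - H x t) := by module
        rw [h1]
        refine (norm_add_le _ _).trans ?_
        rw [norm_smul, norm_smul, Real.norm_of_nonneg hθ0, Real.norm_of_nonneg (sub_nonneg.2 hθ1)]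
        have h3 := mul_nonneg (sub_nonneg.2 hθ1) (sub_nonneg.2 hm0.2.2.le)
        have h4 := mul_nonneg hθ0 (sub_nonneg.2 hm1.2.2.le)
        linarith
      have hsum := (abs_le.1 (abs_sum_mul_hessianMatrix_sub_le (hup (x, t) ⟨hx, htI⟩) hν hH)).1
      refine abs_det_mul_le hν hωx (hlow (x, t) ⟨hx, htI⟩) hpsd hB ?_
      have h5 := (abs_lt.1 hmc).2
      have h6 := mul_le_mul_of_nonneg_left hsum hωx.le
      linarith
  calc volume A ≤ volume (⋃ k ∈ Finset.range N, P k) := measure_mono hcover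
    _ ≤ ∑ k ∈ Finset.range N, volume (P k) := measure_biUnion_finset_le _ _
    _ ≤ ∑ _k ∈ Finset.range N, ENNReal.ofReal τ * ∫⁻ x in closedBall w R, ENNReal.ofReal (F x) :=
        Finset.sum_le_sum hPk
    _ = _ := by
        rw [Finset.sum_const, Finset.card_range, nsmul_eq_mul, ← mul_assoc]
        congr 1
        rw [← ENNReal.ofReal_natCast, ← ENNReal.ofReal_mul hN0.le]
        congr 1
        rw [hτ]; field_simp

end

/-- The error is isolated as η times a combination of ω^{-n} and ω, both locally integrable, so it
disappears as η → 0. The bound η ≤ 1 gives η^{n+1} ≤ η. -/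
theorem perturbed_density_le {n : ℕ} {ν ω f C η : ℝ} (hν : 0 < ν) (hω : 0 < ω) (hf : 0 ≤ f)
    (hC : 0 ≤ C) (hη : 0 ≤ η) (hη1 : η ≤ 1) :
    (f + η + ω * (C * η)) * ((f + η + ω * (C * η)) / (ν * ω)) ^ n ≤
      2 ^ n / ν ^ n * (f ^ (n + 1) / ω ^ n) +
        η * (2 ^ n / ν ^ n * (2 ^ n * ((ω ^ n)⁻¹ + C ^ (n + 1) * ω))) := by
  have h1 : f + η + ω * (C * η) = f + η * (1 + C * ω) := by ring
  have h2 : (f + η * (1 + C * ω)) ^ (n + 1) ≤ 2 ^ n * (f ^ (n + 1) + (η * (1 + C * ω)) ^ (n + 1)) :=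
    add_pow_le hf (by positivity) (n + 1)
  have h3 : (1 + C * ω) ^ (n + 1) ≤ 2 ^ n * (1 ^ (n + 1) + (C * ω) ^ (n + 1)) :=
    add_pow_le zero_le_one (by positivity) (n + 1)
  have h4 : η ^ (n + 1) ≤ η := pow_le_of_le_one hη hη1 (Nat.succ_ne_zero n)
  have h5 : (η * (1 + C * ω)) ^ (n + 1) ≤ η * (2 ^ n * (1 + (C * ω) ^ (n + 1))) := by
    rw [mul_pow]
    rw [one_pow] at h3
    gcongr
  rw [h1]
  calc (f + η * (1 + C * ω)) * ((f + η * (1 + C * ω)) / (ν * ω)) ^ n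
      = (f + η * (1 + C * ω)) ^ (n + 1) / (ν ^ n * ω ^ n) := by
        rw [div_pow, mul_pow, pow_succ]; ring
    _ ≤ (2 ^ n * (f ^ (n + 1) + η * (2 ^ n * (1 + (C * ω) ^ (n + 1))))) / (ν ^ n * ω ^ n) := by
        gcongr
        exact h2.trans (by gcongr)
    _ = _ := by
        rw [mul_pow C ω, pow_succ ω n]
        field_simp

section

variable {n : ℕ} {U : Set (Space n)} {w : Space n} {R t₀ t₁ : ℝ}

theorem volume_le_of_subsolution (hU : IsOpen U) (hR : 0 < R) (hKU : closedBall w R ⊆ U)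
    (ht : t₀ < t₁) {v vt : Space n → ℝ → ℝ} {G : Space n → ℝ → Space n}
    {H : Space n → ℝ → Space n →L[ℝ] Space n}
    (hv : ∀ t ∈ Icc t₀ t₁, HasHessianOn (fun x => v x t) (fun x => G x t) (fun x => H x t) U)
    (hvt : ∀ x ∈ closedBall w R, ∀ t ∈ Icc t₀ t₁, HasDerivAt (v x) (vt x t) t)
    (hvc : ContinuousOn (fun X : Space n × ℝ => v X.1 X.2) (closedBall w R ×ˢ Icc t₀ t₁))
    (hvtc : ContinuousOn (fun X : Space n × ℝ => vt X.1 X.2) (closedBall w R ×ˢ Icc t₀ t₁))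
    (hHc : ContinuousOn (fun X : Space n × ℝ => H X.1 X.2) (closedBall w R ×ˢ Icc t₀ t₁))
    (hlat : ∀ x ∈ sphere w R, ∀ t ∈ Icc t₀ t₁, v x t ≤ 0) (hinit : ∀ x ∈ closedBall w R, v x t₀ ≤ 0)
    {ν η₀ M : ℝ} (hν : 0 < ν) {ω f : Space n → ℝ} (hω : ∀ᵐ x, 0 < ω x)
    (hωi : IntegrableOn ω (closedBall w R)) (hμi : IntegrableOn (dualWeight ω) (closedBall w R))
    (hf0 : ∀ x, 0 ≤ f x) (hfm : AEMeasurable f (volume.restrict (closedBall w R)))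
    {a : Space n × ℝ → Matrix (Fin n) (Fin n) ℝ}
    (hlow : ∀ X ∈ closedBall w R ×ˢ Icc t₀ t₁, ∀ ξ : Space n,
      ν * ‖ξ‖ ^ 2 ≤ ∑ i, ∑ j, a X i j * ξ i * ξ j)
    (hup : ∀ X ∈ closedBall w R ×ˢ Icc t₀ t₁, ∀ i j, |a X i j| ≤ ν⁻¹) (hη₀ : 0 < η₀)
    (hpde : ∀ᵐ X ∂(volume.restrict (closedBall w R ×ˢ Icc t₀ t₁)), -η₀ < v X.1 X.2 →
      vt X.1 X.2 - ω X.1 * ∑ i, ∑ j, a X i j * hessianMatrix (H X.1 X.2) i j ≤ f X.1)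
    (hM : ∃ x ∈ closedBall w R, M ≤ v x t₁) :
    volume {q : Space n × ℝ | 2 * R * ‖q.1‖ < q.2 ∧ q.2 < M / 2} ≤
      ENNReal.ofReal (t₁ - t₀) * ∫⁻ x in closedBall w R, ENNReal.ofReal
        (2 ^ n / ν ^ n * (f x ^ (n + 1) / ω x ^ n)) := by
  set C : ℝ := (n : ℝ) ^ 2 * ν⁻¹ with hC
  have hC0 : 0 ≤ C := by positivity
  set D : Space n → ℝ := fun x => 2 ^ n / ν ^ n * (2 ^ n * (dualWeight ω x + C ^ (n + 1) * ω x))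
    with hD
  have hDi : IntegrableOn D (closedBall w R) :=
    ((hμi.add (hωi.const_mul (C ^ (n + 1)))).const_mul (2 ^ n)).const_mul (2 ^ n / ν ^ n)
  set T := ENNReal.ofReal (t₁ - t₀)
  set I := ∫⁻ x in closedBall w R, ENNReal.ofReal (2 ^ n / ν ^ n * (f x ^ (n + 1) / ω x ^ n))
  set Z := ∫⁻ x in closedBall w R, ENNReal.ofReal (D x)
  have hZ : Z ≠ ∞ := hDi.lintegral_lt_top.ne
  have hTZ : T * Z ≠ ∞ := ENNReal.mul_ne_top ENNReal.ofReal_ne_top hZ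
  have hkey : ∀ η : ℝ, 0 < η → η ≤ min η₀ 1 →
      volume {q : Space n × ℝ | 2 * R * ‖q.1‖ < q.2 ∧ q.2 < M / 2} ≤
        T * I + ENNReal.ofReal η * (T * Z) := by
    intro η hη hη1
    refine (volume_le_of_subsolution_aux hU hR hKU ht hv hvt hvc hvtc hHc hlat hinit hν hω
      hωi.aemeasurable hfm hlow hup hpde hM hη (hη1.trans (min_le_left _ _))).trans ?_
    rw [mul_left_comm, ← mul_add]
    gcongr
    rw [← lintegral_const_mul' _ _ ENNReal.ofReal_ne_top, ← lintegral_add_right']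
    · refine lintegral_mono_ae ?_
      filter_upwards [ae_restrict_of_ae hω] with x hx
      rw [← ENNReal.ofReal_mul hη.le]
      refine (ENNReal.ofReal_le_ofReal (perturbed_density_le hν hx (hf0 x) hC0 hη.le
        (hη1.trans (min_le_right _ _)))).trans ENNReal.ofReal_add_le
    · exact (hDi.aemeasurable.ennreal_ofReal).const_mul _
  have hlim : Tendsto (fun η : ℝ => T * I + ENNReal.ofReal η * (T * Z)) (𝓝[>] 0)
      (𝓝 (T * I + ENNReal.ofReal 0 * (T * Z))) :=
    tendsto_const_nhds.add (ENNReal.Tendsto.mul_const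
      ((ENNReal.continuous_ofReal.tendsto 0).mono_left nhdsWithin_le_nhds) (Or.inr hTZ))
  rw [ENNReal.ofReal_zero, zero_mul, add_zero] at hlim
  refine ge_of_tendsto hlim ?_
  filter_upwards [Ioc_mem_nhdsGT (lt_min hη₀ one_pos)] with η hη
  exact hkey η hη.1 hη.2

/-- The cone contains the product of the ball of radius M/(8R) and the interval (M/4, M/2). -/
theorem volume_cone_ge (hn : 1 ≤ n) (hR : 0 < R) {M : ℝ} (hM : 0 < M) :
    ENNReal.ofReal ((M / (8 * R)) ^ n * (M / 4)) * volume (ball (0 : Space n) 1) ≤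
      volume {q : Space n × ℝ | 2 * R * ‖q.1‖ < q.2 ∧ q.2 < M / 2} := by
  have : Nonempty (Fin n) := ⟨⟨0, hn⟩⟩
  have hsub : ball (0 : Space n) (M / (8 * R)) ×ˢ Ioo (M / 4) (M / 2) ⊆
      {q : Space n × ℝ | 2 * R * ‖q.1‖ < q.2 ∧ q.2 < M / 2} := by
    rintro ⟨p, h⟩ ⟨hp, hh⟩
    simp only [mem_ball, dist_zero_right, mem_Ioo] at hp hh
    refine ⟨?_, hh.2⟩
    rw [lt_div_iff₀ (by positivity)] at hp
    simp only
    linarith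
  refine le_trans (le_of_eq ?_) (measure_mono hsub)
  rw [Measure.volume_eq_prod, Measure.prod_prod, Real.volume_Ioo,
    Measure.addHaar_ball volume (0 : Space n) (r := M / (8 * R)) (by positivity),
    ENNReal.ofReal_mul (by positivity)]
  simp only [finrank_euclideanSpace, Fintype.card_fin]
  rw [show M / 2 - M / 4 = M / 4 by ring]
  ring

end

/-! ### Functions of class `C^{2,1}` -/

/-- The spatial gradient. -/
def spaceGrad {n : ℕ} (u : SpaceTime n → ℝ) (x : Space n) (t : ℝ) : Space n :=
  WithLp.toLp 2 fun i => spaceDeriv i u (x, t)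

/-- The spatial Hessian. -/
def spaceHess {n : ℕ} (u : SpaceTime n → ℝ) (x : Space n) (t : ℝ) : Space n →L[ℝ] Space n :=
  ofComponents fun i =>
    innerSL ℝ (WithLp.toLp 2 fun j => spaceDeriv j (spaceDeriv i u) (x, t) : Space n)

theorem hessianMatrix_spaceHess {n : ℕ} (u : SpaceTime n → ℝ) (x : Space n) (t : ℝ) (i j : Fin n) :
    hessianMatrix (spaceHess u x t) i j = spaceDeriv i (spaceDeriv j u) (x, t) := by
  simp [hessianMatrix, spaceHess, ofComponents, Finset.sum_apply, Pi.single_apply, EuclideanSpace.inner_single_right]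

theorem hasLineDerivAt_slice {n : ℕ} {f : SpaceTime n → ℝ} {x : Space n} {t : ℝ} {i : Fin n}
    (h : LineDifferentiableAt ℝ f (x, t) (eSpace i)) :
    HasLineDerivAt ℝ (fun y => f (y, t)) (spaceDeriv i f (x, t)) x (EuclideanSpace.single i 1) := by
  have h1 : HasDerivAt (fun s : ℝ => f ((x, t) + s • eSpace i)) (spaceDeriv i f (x, t)) 0 :=
    h.hasLineDerivAt
  have h2 : HasDerivAt (fun s : ℝ => f (x + s • EuclideanSpace.single i 1, t))
      (spaceDeriv i f (x, t)) 0 := by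
    simpa [eSpace] using h1
  exact h2

theorem hasDerivAt_time {n : ℕ} {f : SpaceTime n → ℝ} {x : Space n} {t : ℝ}
    (h : LineDifferentiableAt ℝ f (x, t) (eTime n)) :
    HasDerivAt (fun s => f (x, s)) (timeDeriv f (x, t)) t := by
  have h1 : HasDerivAt (fun s : ℝ => f ((x, t) + s • eTime n)) (timeDeriv f (x, t)) 0 :=
    h.hasLineDerivAt
  have h2 : HasDerivAt (fun s : ℝ => f (x, t + s)) (timeDeriv f (x, t)) 0 := by
    simpa [eTime] using h1
  have h3 : HasDerivAt (fun s : ℝ => f (x, t + s)) (timeDeriv f (x, t)) (t - t) := by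
    rwa [sub_self]
  simpa using h3.comp_sub_const t t

theorem IsC21On.continuousOn_spaceHess {n : ℕ} {u : SpaceTime n → ℝ} {Ω : Set (SpaceTime n)}
    (hu : IsC21On u Ω) : ContinuousOn (fun X : Space n × ℝ => spaceHess u X.1 X.2) Ω := by
  have h : ∀ i, ContinuousOn (fun X : Space n × ℝ => (innerSL ℝ
      (WithLp.toLp 2 fun j => spaceDeriv j (spaceDeriv i u) (X.1, X.2) : Space n)).smulRight
        (EuclideanSpace.single i (1 : ℝ))) Ω := by
    intro i
    have h1 : ContinuousOn (fun X : Space n × ℝ =>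
        (WithLp.toLp 2 fun j => spaceDeriv j (spaceDeriv i u) (X.1, X.2) : Space n)) Ω :=
      (PiLp.continuous_toLp 2 _).comp_continuousOn
        (continuousOn_pi.2 fun j => hu.space2_cont j i)
    have h2 := (innerSL ℝ (E := Space n)).continuous.comp_continuousOn h1
    exact ((ContinuousLinearMap.smulRightL ℝ (Space n) (Space n)).flip
      (EuclideanSpace.single i (1 : ℝ))).continuous.comp_continuousOn h2
  unfold spaceHess ofComponents
  exact continuousOn_finsetSum _ fun i _ => h i

/-- On a time slice all first and second partial derivatives are continuous, so
`hasFDerivAt_of_partial` applies to u and then to each D_i u. -/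
theorem IsC21On.hasHessianOn {n : ℕ} {u : SpaceTime n → ℝ} {Ω : Set (SpaceTime n)}
    (hu : IsC21On u Ω) {U : Set (Space n)} (hU : IsOpen U) {t : ℝ}
    (hUΩ : ∀ x ∈ U, (x, t) ∈ Ω) :
    HasHessianOn (fun x => u (x, t)) (fun x => spaceGrad u x t) (fun x => spaceHess u x t) U := by
  have hmaps : MapsTo (fun x : Space n => (x, t)) U Ω := hUΩ
  have hc : ContinuousOn (fun x : Space n => (x, t)) U := by fun_prop
  have hd1 : ∀ i, ∀ x ∈ U, ContinuousAt (fun x => spaceDeriv i u (x, t)) x := fun i x hx =>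
    ((hu.space_cont i).comp hc hmaps).continuousAt (hU.mem_nhds hx)
  have hd2 : ∀ i j, ∀ x ∈ U, ContinuousAt (fun x => spaceDeriv j (spaceDeriv i u) (x, t)) x :=
    fun i j x hx => ((hu.space2_cont j i).comp hc hmaps).continuousAt (hU.mem_nhds hx)
  have hl1 : ∀ i, ∀ x ∈ U, ∀ᶠ y in 𝓝 x, HasLineDerivAt ℝ (fun y => u (y, t))
      (spaceDeriv i u (y, t)) y (EuclideanSpace.single i 1) := fun i x hx => by
    filter_upwards [hU.mem_nhds hx] with y hy
    exact hasLineDerivAt_slice (hu.space_diff i _ (hUΩ y hy))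
  have hl2 : ∀ i j, ∀ x ∈ U, ∀ᶠ y in 𝓝 x, HasLineDerivAt ℝ (fun y => spaceDeriv i u (y, t))
      (spaceDeriv j (spaceDeriv i u) (y, t)) y (EuclideanSpace.single j 1) := fun i j x hx => by
    filter_upwards [hU.mem_nhds hx] with y hy
    exact hasLineDerivAt_slice (hu.space2_diff j i _ (hUΩ y hy))
  refine ⟨fun x hx => ?_, fun x hx => ?_, ?_⟩
  · exact hasFDerivAt_of_partial (d := fun i x => spaceDeriv i u (x, t)) (fun i => hl1 i x hx)
      fun i => hd1 i x hx
  · have h : ∀ i, HasFDerivAt (fun y => spaceDeriv i u (y, t)) (innerSL ℝ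
        (WithLp.toLp 2 fun j => spaceDeriv j (spaceDeriv i u) (x, t) : Space n)) x := fun i =>
      hasFDerivAt_of_partial (d := fun j x => spaceDeriv j (spaceDeriv i u) (x, t))
        (fun j => hl2 i j x hx) fun j => hd2 i j x hx
    unfold spaceGrad spaceHess
    exact hasFDerivAt_toLp_of_components h
  · have h1 := hu.continuousOn_spaceHess
    have h2 : ContinuousOn ((fun X : Space n × ℝ => spaceHess u X.1 X.2) ∘
      fun x : Space n => (x, t)) U := h1.comp hc hmaps
    exact h2

/-! ### The barrier -/

section Barrier

variable {n : ℕ}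

/-- `ϱ(t)² - |x - ζ(t)|²` for a ball `B_{ϱ(t)}(ζ(t))` that moves from `B_{R/4}(z)` to `B_{3R/4}(w)`
in time `T`. -/
def movingBall (z w : Space n) (R t₀ T : ℝ) (x : Space n) (t : ℝ) : ℝ :=
  (R / 4 + (t - t₀) / T * (R / 2)) ^ 2 - ‖x - (z + ((t - t₀) / T) • (w - z))‖ ^ 2

def movingBallDeriv (z w : Space n) (R t₀ T : ℝ) (x : Space n) (t : ℝ) : ℝ :=
  (R / 4 + (t - t₀) / T * (R / 2)) * (R / T) +
    2 / T * ⟪x - (z + ((t - t₀) / T) • (w - z)), w - z⟫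

/-- The odd power gives the barrier the sign of `movingBall`, so no positive part is taken and it
stays smooth. A power above one produces the rank-one Hessian term that helps near the boundary of
the ball; the exponential handles the interior. -/
def barrier (z w : Space n) (R t₀ T q Λ : ℝ) (x : Space n) (t : ℝ) : ℝ :=
  Λ * Real.exp (-(q * (t - t₀))) * movingBall z w R t₀ T x t ^ 3

def barrierDeriv (z w : Space n) (R t₀ T q Λ : ℝ) (x : Space n) (t : ℝ) : ℝ :=
  Λ * Real.exp (-(q * (t - t₀))) * (3 * movingBall z w R t₀ T x t ^ 2 *
    movingBallDeriv z w R t₀ T x t - q * movingBall z w R t₀ T x t ^ 3)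

def barrierGrad (z w : Space n) (R t₀ T q Λ : ℝ) (x : Space n) (t : ℝ) : Space n :=
  (Λ * Real.exp (-(q * (t - t₀))) * (-6 * movingBall z w R t₀ T x t ^ 2)) •
    (x - (z + ((t - t₀) / T) • (w - z)))

def barrierHess (z w : Space n) (R t₀ T q Λ : ℝ) (x : Space n) (t : ℝ) :
    Space n →L[ℝ] Space n :=
  (Λ * Real.exp (-(q * (t - t₀)))) • ((-6 * movingBall z w R t₀ T x t ^ 2) •
    ContinuousLinearMap.id ℝ (Space n) + (24 * movingBall z w R t₀ T x t) •
      (innerSL ℝ (x - (z + ((t - t₀) / T) • (w - z)))).smulRight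
        (x - (z + ((t - t₀) / T) • (w - z))))

variable (z w : Space n) (R t₀ T q Λ : ℝ)

theorem continuous_movingBall :
    Continuous fun X : Space n × ℝ => movingBall z w R t₀ T X.1 X.2 := by
  unfold movingBall; fun_prop

theorem continuous_barrier :
    Continuous fun X : Space n × ℝ => barrier z w R t₀ T q Λ X.1 X.2 := by
  have := continuous_movingBall z w R t₀ T
  unfold barrier; fun_prop

theorem continuous_barrierDeriv :
    Continuous fun X : Space n × ℝ => barrierDeriv z w R t₀ T q Λ X.1 X.2 := by
  have := continuous_movingBall z w R t₀ T
  unfold barrierDeriv movingBallDeriv; fun_prop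

theorem continuous_barrierHess :
    Continuous fun X : Space n × ℝ => barrierHess z w R t₀ T q Λ X.1 X.2 := by
  have := continuous_movingBall z w R t₀ T
  have hy : Continuous fun X : Space n × ℝ => X.1 - (z + ((X.2 - t₀) / T) • (w - z)) := by fun_prop
  have h2 : Continuous fun X : Space n × ℝ =>
      (innerSL ℝ (X.1 - (z + ((X.2 - t₀) / T) • (w - z)))).smulRight
        (X.1 - (z + ((X.2 - t₀) / T) • (w - z))) :=
    ((ContinuousLinearMap.smulRightL ℝ (Space n) (Space n)).continuous.comp
      ((innerSL ℝ (E := Space n)).continuous.comp hy)).clm_apply hy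
  unfold barrierHess; fun_prop

theorem hasFDerivAt_movingBall (x : Space n) (t : ℝ) :
    HasFDerivAt (fun x => movingBall z w R t₀ T x t)
      (innerSL ℝ ((-2 : ℝ) • (x - (z + ((t - t₀) / T) • (w - z))))) x := by
  unfold movingBall
  have h1 := ((hasFDerivAt_id x).sub_const (z + ((t - t₀) / T) • (w - z))).norm_sq
  refine (h1.const_sub _).congr_fderiv ?_
  ext ξ
  simp

theorem hasDerivAt_movingBall (x : Space n) (t : ℝ) :
    HasDerivAt (fun t => movingBall z w R t₀ T x t) (movingBallDeriv z w R t₀ T x t) t := by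
  unfold movingBall movingBallDeriv
  have hθ : HasDerivAt (fun t => (t - t₀) / T) (1 / T) t := ((hasDerivAt_id t).sub_const t₀).div_const T
  have h1 := ((hθ.mul_const (R / 2)).const_add (R / 4)).pow 2
  have h2 := (((hθ.smul_const (w - z)).const_add z).const_sub x).norm_sq
  refine (h1.sub h2).congr_deriv ?_
  simp only [inner_neg_right, real_inner_smul_right]
  push_cast
  ring

theorem hasDerivAt_barrier (x : Space n) (t : ℝ) :
    HasDerivAt (fun t => barrier z w R t₀ T q Λ x t) (barrierDeriv z w R t₀ T q Λ x t) t := by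
  unfold barrier barrierDeriv
  have h1 := ((((hasDerivAt_id t).sub_const t₀).const_mul q).neg.exp.const_mul Λ).mul
    ((hasDerivAt_movingBall z w R t₀ T x t).pow 3)
  refine h1.congr_deriv ?_
  simp only [id, Pi.neg_apply, Pi.pow_apply]
  push_cast
  ring

theorem hasHessianOn_barrier (t : ℝ) (U : Set (Space n)) :
    HasHessianOn (fun x => barrier z w R t₀ T q Λ x t) (fun x => barrierGrad z w R t₀ T q Λ x t)
      (fun x => barrierHess z w R t₀ T q Λ x t) U where
  grad x _ := by
    have h := ((hasFDerivAt_movingBall z w R t₀ T x t).pow 3).const_mul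
      (Λ * Real.exp (-(q * (t - t₀))))
    refine h.congr_fderiv ?_
    ext ξ
    simp only [barrierGrad, smul_apply, innerSL_apply_apply,
      real_inner_smul_left, smul_eq_mul]
    push_cast
    ring
  hess x _ := by
    have h1 := (((hasFDerivAt_movingBall z w R t₀ T x t).pow 2).const_mul (-6)).const_mul
      (Λ * Real.exp (-(q * (t - t₀))))
    have h := h1.smul ((hasFDerivAt_id x).sub_const (z + ((t - t₀) / T) • (w - z)))
    refine h.congr_fderiv ?_
    ext1 ξ
    simp only [barrierHess, smul_apply, innerSL_apply_apply,
      real_inner_smul_left, smul_eq_mul, add_apply,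
      ContinuousLinearMap.smulRight_apply, ContinuousLinearMap.id_apply, id]
    module
  cont := by
    have := (continuous_barrierHess z w R t₀ T q Λ).comp
      (by fun_prop : Continuous fun x : Space n => (x, t))
    exact this.continuousOn

theorem hessianMatrix_barrierHess (x : Space n) (t : ℝ) (i j : Fin n) :
    hessianMatrix (barrierHess z w R t₀ T q Λ x t) i j = Λ * Real.exp (-(q * (t - t₀))) *
      (-6 * movingBall z w R t₀ T x t ^ 2 * (if i = j then 1 else 0) +
        24 * movingBall z w R t₀ T x t * ((x - (z + ((t - t₀) / T) • (w - z))) i *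
          (x - (z + ((t - t₀) / T) • (w - z))) j)) := by
  have : (EuclideanSpace.single i (1 : ℝ) : Space n) j = if i = j then 1 else 0 := by
    simp [eq_comm]
  simp only [hessianMatrix, barrierHess, smul_apply,
    add_apply, ContinuousLinearMap.smulRight_apply,
    ContinuousLinearMap.id_apply, innerSL_apply_apply, PiLp.add_apply, PiLp.smul_apply, this,
    EuclideanSpace.inner_single_right, smul_eq_mul]
  simp

theorem sum_mul_hessianMatrix_barrierHess (a : Matrix (Fin n) (Fin n) ℝ) (x : Space n) (t : ℝ) :
    ∑ i, ∑ j, a i j * hessianMatrix (barrierHess z w R t₀ T q Λ x t) i j =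
      Λ * Real.exp (-(q * (t - t₀))) * (-6 * movingBall z w R t₀ T x t ^ 2 * ∑ i, a i i +
        24 * movingBall z w R t₀ T x t * ∑ i, ∑ j, a i j *
          (x - (z + ((t - t₀) / T) • (w - z))) i * (x - (z + ((t - t₀) / T) • (w - z))) j) := by
  simp only [hessianMatrix_barrierHess]
  have : ∀ i, a i i = ∑ j, a i j * (if i = j then 1 else 0) := fun i => by simp
  simp only [this, Finset.mul_sum, ← Finset.sum_add_distrib]
  refine Finset.sum_congr rfl fun i _ => Finset.sum_congr rfl fun j _ => ?_
  ring

end Barrier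

/-! ### Size of the barrier and the subsolution property -/

section Barrier

variable {n : ℕ} {z w : Space n} {R t₀ T q Λ : ℝ}

theorem movingBall_initial (x : Space n) :
    movingBall z w R t₀ T x t₀ = (R / 4) ^ 2 - ‖x - z‖ ^ 2 := by
  simp [movingBall]

theorem movingBall_final (hT : T ≠ 0) (x : Space n) :
    movingBall z w R t₀ T x (t₀ + T) = (3 * R / 4) ^ 2 - ‖x - w‖ ^ 2 := by
  simp only [movingBall, add_sub_cancel_left, div_self hT, one_smul, one_mul]
  rw [add_sub_cancel]
  ring

/-- With θ the elapsed fraction of time, the centre is at distance at most (1 - θ)R/2 from w and the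
radius is 3R/4 - (1 - θ)R/2. The moving ball therefore never leaves B_{3R/4}(w). -/
theorem movingBall_nonpos (hR : 0 < R) (hT : 0 < T) (hzw : ‖w - z‖ ≤ R / 2) {t : ℝ}
    (ht : t ∈ Icc t₀ (t₀ + T)) {x : Space n} (hx : 3 * R / 4 ≤ ‖x - w‖) :
    movingBall z w R t₀ T x t ≤ 0 := by
  unfold movingBall
  have h0 : 0 ≤ (t - t₀) / T := div_nonneg (sub_nonneg.2 ht.1) hT.le
  have h1 : (t - t₀) / T ≤ 1 := by rw [div_le_one hT]; linarith [ht.2]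
  set θ := (t - t₀) / T
  have h2 : x - w = (x - (z + θ • (w - z))) - (1 - θ) • (w - z) := by module
  have h3 : ‖x - w‖ ≤ ‖x - (z + θ • (w - z))‖ + (1 - θ) * ‖w - z‖ := by
    conv_lhs => rw [h2]
    refine (norm_sub_le _ _).trans_eq ?_
    rw [norm_smul, Real.norm_of_nonneg (sub_nonneg.2 h1)]
  have h4 : (1 - θ) * ‖w - z‖ ≤ (1 - θ) * (R / 2) :=
    mul_le_mul_of_nonneg_left hzw (sub_nonneg.2 h1)
  have h5 : R / 4 + θ * (R / 2) ≤ ‖x - (z + θ • (w - z))‖ := by linarith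
  have h6 : 0 ≤ R / 4 + θ * (R / 2) := by positivity
  have := pow_le_pow_left₀ h6 h5 2
  linarith

/-- The decay rate that makes the barrier a subsolution. -/
def barrierRate (n : ℕ) (R T ν m : ℝ) : ℝ :=
  (9 * R ^ 2 / (2 * T) + 6 * m * n / ν + 24 * m * ν) ^ 2 / (6 * m * ν * R ^ 2)

theorem movingBall_estimates (hR : 0 < R) (hT : 0 < T) (hzw : ‖w - z‖ ≤ R / 2) {t : ℝ}
    (ht : t ∈ Icc t₀ (t₀ + T)) {x : Space n} (hg : 0 < movingBall z w R t₀ T x t) :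
    R ^ 2 / 16 - movingBall z w R t₀ T x t ≤ ‖x - (z + ((t - t₀) / T) • (w - z))‖ ^ 2 ∧
      ‖x - (z + ((t - t₀) / T) • (w - z))‖ ≤ R ∧ movingBall z w R t₀ T x t ≤ R ^ 2 ∧
      movingBallDeriv z w R t₀ T x t ≤ 3 * R ^ 2 / (2 * T) := by
  have h0 : 0 ≤ (t - t₀) / T := div_nonneg (sub_nonneg.2 ht.1) hT.le
  have h1 : (t - t₀) / T ≤ 1 := by rw [div_le_one hT]; linarith [ht.2]
  unfold movingBallDeriv
  unfold movingBall at hg ⊢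
  set θ := (t - t₀) / T
  set y := x - (z + θ • (w - z))
  set ϱ := R / 4 + θ * (R / 2) with hϱ
  have hθR : 0 ≤ θ * (R / 2) := by positivity
  have hθR1 : θ * (R / 2) ≤ 1 * (R / 2) := by gcongr
  have hϱ0 : R / 4 ≤ ϱ := by linarith
  have hϱ1 : ϱ ≤ 3 * R / 4 := by linarith
  have hy : ‖y‖ ≤ ϱ := by
    have : ‖y‖ ^ 2 ≤ ϱ ^ 2 := by linarith
    exact le_of_sq_le_sq this (by linarith)
  have hsq0 : (R / 4) ^ 2 ≤ ϱ ^ 2 := by gcongr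
  have hsq1 : ϱ ^ 2 ≤ (3 * R / 4) ^ 2 := pow_le_pow_left₀ (by linarith) hϱ1 2
  refine ⟨by linarith, by linarith, by nlinarith [sq_nonneg ‖y‖, sq_nonneg R], ?_⟩
  have hin : ⟪y, w - z⟫ ≤ 3 * R / 4 * (R / 2) :=
    (real_inner_le_norm _ _).trans (by gcongr; linarith)
  calc ϱ * (R / T) + 2 / T * ⟪y, w - z⟫ ≤ 3 * R / 4 * (R / T) + 2 / T * (3 * R / 4 * (R / 2)) := by
        gcongr
    _ = _ := by field_simp; ring

/-- After division by the positive factor Λ exp(-q(t - t₀)) g, with g the value of `movingBall`, the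
claim reduces to the nonpositivity of a quadratic polynomial in g. Its constant term -3mνR²/2 comes
from the rank-one part of the Hessian and ‖x - ζ‖² ≥ R²/16 - g. -/
theorem barrier_subsolution {ν m : ℝ} (hR : 0 < R) (hT : 0 < T) (hν : 0 < ν) (hm : 0 < m)
    (hΛ : 0 ≤ Λ) (hzw : ‖w - z‖ ≤ R / 2) {a : Matrix (Fin n) (Fin n) ℝ}
    (hlow : ∀ ξ : Space n, ν * ‖ξ‖ ^ 2 ≤ ∑ i, ∑ j, a i j * ξ i * ξ j)
    (hup : ∀ i j, |a i j| ≤ ν⁻¹) {t : ℝ}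
    (ht : t ∈ Icc t₀ (t₀ + T)) {x : Space n} (hg : 0 < movingBall z w R t₀ T x t) :
    barrierDeriv z w R t₀ T (barrierRate n R T ν m) Λ x t - m * ∑ i, ∑ j, a i j *
      hessianMatrix (barrierHess z w R t₀ T (barrierRate n R T ν m) Λ x t) i j ≤ 0 := by
  rw [sum_mul_hessianMatrix_barrierHess]
  obtain ⟨h1, h2, h3, h4⟩ := movingBall_estimates hR hT hzw ht hg
  have hl := hlow (x - (z + ((t - t₀) / T) • (w - z)))
  unfold barrierDeriv
  set g := movingBall z w R t₀ T x t
  set y := x - (z + ((t - t₀) / T) • (w - z))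
  set Q := ∑ i, ∑ j, a i j * y i * y j
  have htr : ∑ i, a i i ≤ n / ν := by
    calc ∑ i, a i i ≤ ∑ _i : Fin n, ν⁻¹ :=
          Finset.sum_le_sum fun i _ => (le_abs_self _).trans (hup i i)
      _ = n / ν := by simp [div_eq_mul_inv]
  set q := barrierRate n R T ν m with hq
  set Mc := 9 * R ^ 2 / (2 * T) + 6 * m * n / ν + 24 * m * ν with hMc
  have hqM : q * (6 * m * ν * R ^ 2) = Mc ^ 2 := by
    rw [hq]; exact div_mul_cancel₀ _ (by positivity)
  -- `barrierRate` is the value of q for which this quadratic has zero discriminant, so the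
  -- inequality is a completed square.
  have hsq : g * Mc ≤ q * g ^ 2 + 3 / 2 * m * ν * R ^ 2 := by
    have h5 : 0 ≤ (Mc * g - 3 * m * ν * R ^ 2) ^ 2 := sq_nonneg _
    have h6 : 0 < 6 * m * ν * R ^ 2 := by positivity
    refine le_of_mul_le_mul_right ?_ h6
    have : q * g ^ 2 * (6 * m * ν * R ^ 2) = Mc ^ 2 * g ^ 2 := by rw [← hqM]; ring
    nlinarith
  have hb : 3 * g * movingBallDeriv z w R t₀ T x t - q * g ^ 2 + 6 * m * g * ∑ i, a i i -
      24 * m * Q ≤ 0 := by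
    have e1 : 3 * g * movingBallDeriv z w R t₀ T x t ≤ 3 * g * (3 * R ^ 2 / (2 * T)) := by gcongr
    have e2 : 6 * m * g * ∑ i, a i i ≤ 6 * m * g * (n / ν) := by gcongr
    have e3 : 24 * m * (ν * (R ^ 2 / 16 - g)) ≤ 24 * m * Q := by
      gcongr
      exact (mul_le_mul_of_nonneg_left h1 hν.le).trans hl
    have e4 : g * Mc = 3 * g * (3 * R ^ 2 / (2 * T)) + 6 * m * g * (n / ν) + 24 * m * ν * g := by
      rw [hMc]; ring
    nlinarith
  have hfac : Λ * Real.exp (-(q * (t - t₀))) * (3 * g ^ 2 * movingBallDeriv z w R t₀ T x t -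
      q * g ^ 3) - m * (Λ * Real.exp (-(q * (t - t₀))) * (-6 * g ^ 2 * ∑ i, a i i + 24 * g * Q)) =
      Λ * Real.exp (-(q * (t - t₀))) * g * (3 * g * movingBallDeriv z w R t₀ T x t - q * g ^ 2 +
        6 * m * g * ∑ i, a i i - 24 * m * Q) := by ring
  rw [hfac]
  exact mul_nonpos_of_nonneg_of_nonpos (by positivity) hb

/-- This is the cost of freezing ω, to be multiplied by |ω - m|. The 30 is 6 + 24, from the two
Hessian terms with g ≤ R² and ‖x - ζ‖ ≤ R. -/
theorem abs_sum_barrierHess_le {ν : ℝ} (hR : 0 < R) (hT : 0 < T) (hν : 0 < ν)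
    (hΛ : 0 ≤ Λ) (hq : 0 ≤ q) (hzw : ‖w - z‖ ≤ R / 2) {a : Matrix (Fin n) (Fin n) ℝ}
    (hup : ∀ i j, |a i j| ≤ ν⁻¹) {t : ℝ}
    (ht : t ∈ Icc t₀ (t₀ + T)) {x : Space n} (hg : 0 < movingBall z w R t₀ T x t) :
    |∑ i, ∑ j, a i j * hessianMatrix (barrierHess z w R t₀ T q Λ x t) i j| ≤
      Λ * (30 * n ^ 2 * ν⁻¹ * R ^ 4) := by
  obtain ⟨-, h2, h3, -⟩ := movingBall_estimates hR hT hzw ht hg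
  have hentry : ∀ i j, |hessianMatrix (barrierHess z w R t₀ T q Λ x t) i j| ≤
      Λ * (30 * R ^ 4) := by
    intro i j
    rw [hessianMatrix_barrierHess]
    set g := movingBall z w R t₀ T x t
    set y := x - (z + ((t - t₀) / T) • (w - z))
    have hyi : ∀ i, |y i| ≤ R := fun i => (PiLp.norm_apply_le y i).trans h2
    have hexp : Real.exp (-(q * (t - t₀))) ≤ 1 := by
      rw [Real.exp_le_one_iff]
      have := mul_nonneg hq (sub_nonneg.2 ht.1)
      linarith
    rw [abs_mul, abs_mul, abs_of_nonneg hΛ, Real.abs_exp]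
    have e1 : |-6 * g ^ 2 * (if i = j then (1 : ℝ) else 0)| ≤ 6 * (R ^ 2) ^ 2 := by
      have : |(if i = j then (1 : ℝ) else 0)| ≤ 1 := by split_ifs <;> simp
      rw [abs_mul, abs_mul, abs_neg, abs_of_nonneg (by norm_num : (0 : ℝ) ≤ 6),
        abs_of_nonneg (sq_nonneg g)]
      calc 6 * g ^ 2 * |(if i = j then (1 : ℝ) else 0)| ≤ 6 * g ^ 2 * 1 := by gcongr
        _ ≤ _ := by rw [mul_one]; gcongr
    have e2 : |24 * g * (y i * y j)| ≤ 24 * R ^ 2 * (R * R) := by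
      rw [abs_mul, abs_mul, abs_mul, abs_of_pos hg, abs_of_nonneg (by norm_num : (0 : ℝ) ≤ 24)]
      gcongr
      · exact hyi i
      · exact hyi j
    calc _ ≤ Λ * 1 * (6 * (R ^ 2) ^ 2 + 24 * R ^ 2 * (R * R)) := by
          gcongr
          exact (abs_add_le _ _).trans (add_le_add e1 e2)
      _ = _ := by ring
  calc _ ≤ ∑ i, |∑ j, a i j * hessianMatrix (barrierHess z w R t₀ T q Λ x t) i j| :=
        Finset.abs_sum_le_sum_abs _ _
    _ ≤ ∑ _i : Fin n, ∑ _j : Fin n, ν⁻¹ * (Λ * (30 * R ^ 4)) := by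
        refine Finset.sum_le_sum fun i _ => (Finset.abs_sum_le_sum_abs _ _).trans
          (Finset.sum_le_sum fun j _ => ?_)
        rw [abs_mul]
        exact mul_le_mul (hup i j) (hentry i j) (abs_nonneg _) (inv_nonneg.2 hν.le)
    _ = _ := by simp; ring

theorem barrierRate_nonneg {ν m : ℝ} (hν : 0 < ν) (hm : 0 < m) : 0 ≤ barrierRate n R T ν m := by
  unfold barrierRate; positivity

/-- The total decay exponent depends on R, T and m only through mT/R², which is trapped between κ
and K. -/
theorem barrierRate_mul_le {ν m κ K : ℝ} (hR : 0 < R) (hT : 0 < T) (hν : 0 < ν)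
    (hm : 0 < m) (hκ : 0 < κ) (h1 : κ ≤ m * T / R ^ 2) (h2 : m * T / R ^ 2 ≤ K) :
    barrierRate n R T ν m * T ≤ K / (6 * ν) * (9 / (2 * κ) + 6 * n / ν + 24 * ν) ^ 2 := by
  set X := m * T / R ^ 2 with hX
  have hX0 : 0 < X := by positivity
  have : barrierRate n R T ν m * T = X / (6 * ν) * (9 / (2 * X) + 6 * n / ν + 24 * ν) ^ 2 := by
    rw [barrierRate, hX]
    field_simp
  rw [this]
  have hK : 0 ≤ K := hX0.le.trans h2
  gcongr

end Barrier

/-! ### Consequences of the Muckenhoupt condition -/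

section Weights

variable {n : ℕ} {ω : Space n → ℝ} {K₀ R : ℝ} {w : Space n}

theorem ofReal_rpow_neg_natCast {x : ℝ} (hx : 0 < x) (n : ℕ) :
    ENNReal.ofReal x ^ (-(n : ℝ)) = ENNReal.ofReal ((x ^ n)⁻¹) := by
  rw [ENNReal.ofReal_rpow_of_pos hx, Real.rpow_neg hx.le, Real.rpow_natCast]

theorem IsMuckenhoupt.integrableOn_ball {p : ℝ} (hω : IsMuckenhoupt p ω) (w : Space n) (R : ℝ) :
    IntegrableOn ω (ball w R) :=
  (hω.locallyIntegrable.integrableOn_isCompact (isCompact_closedBall w R)).mono_set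
    ball_subset_closedBall

theorem IsMuckenhoupt.dualWeight_nonneg {p : ℝ} (hω : IsMuckenhoupt p ω) (x : Space n) :
    0 ≤ dualWeight ω x := inv_nonneg.2 (pow_nonneg (hω.nonneg x) n)

theorem IsMuckenhoupt.setAverage_dualWeight_nonneg {p : ℝ} (hω : IsMuckenhoupt p ω)
    (w : Space n) (R : ℝ) : 0 ≤ ⨍ x in ball w R, dualWeight ω x :=
  integral_nonneg hω.dualWeight_nonneg

theorem IsMuckenhoupt.setAverage_pos {p : ℝ} (hω : IsMuckenhoupt p ω) (w : Space n) (hR : 0 < R) :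
    0 < ⨍ x in ball w R, ω x := by
  rw [setAverage_eq, smul_eq_mul]
  have hvol : 0 < volume.real (ball w R) := ENNReal.toReal_pos
    (measure_ball_pos _ _ hR).ne' measure_ball_lt_top.ne
  refine mul_pos (inv_pos.2 hvol) ?_
  rw [setIntegral_pos_iff_support_of_nonneg_ae (Eventually.of_forall hω.nonneg)
    (hω.integrableOn_ball w R)]
  refine (measure_ball_pos volume w hR).trans_le (measure_mono_ae ?_)
  filter_upwards [hω.pos_ae] with x hx hxB
  exact ⟨hx.ne', hxB⟩

theorem IsMuckenhoupt.ofReal_average_mul_lintegral_le (hn : 1 ≤ n)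
    (hω : IsMuckenhoupt (1 + 1 / (n : ℝ)) ω)
    (hK : muckenhouptConst (1 + 1 / (n : ℝ)) ω ≤ ENNReal.ofReal K₀) (w : Space n) (hR : 0 < R) :
    (ENNReal.ofReal (⨍ x in ball w R, ω x)) *
      ((∫⁻ x in ball w R, ENNReal.ofReal (dualWeight ω x)) / volume (ball w R)) ^ (1 / (n : ℝ)) ≤
        ENNReal.ofReal K₀ := by
  have hn0 : (n : ℝ) ≠ 0 := by positivity
  rw [ofReal_setAverage (hω.integrableOn_ball w R) (Eventually.of_forall hω.nonneg)]
  refine le_trans (le_of_eq ?_) ((le_iSup₂_of_le w R (le_iSup_of_le hR le_rfl)).trans hK)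
  have h1 : (1 + 1 / (n : ℝ) - 1) = 1 / n := by ring
  simp only [h1]
  rw [one_div_one_div]
  congr 3
  refine lintegral_congr_ae ?_
  filter_upwards [ae_restrict_of_ae hω.pos_ae] with x hx
  rw [ofReal_rpow_neg_natCast hx]
  rfl

/-- The mean of ω is positive, so an infinite mean of ω^{-n} would make the Muckenhoupt product
infinite. -/
theorem IsMuckenhoupt.integrableOn_dualWeight (hn : 1 ≤ n)
    (hω : IsMuckenhoupt (1 + 1 / (n : ℝ)) ω)
    (hK : muckenhouptConst (1 + 1 / (n : ℝ)) ω ≤ ENNReal.ofReal K₀) (w : Space n) (hR : 0 < R) :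
    IntegrableOn (dualWeight ω) (ball w R) := by
  have h := hω.ofReal_average_mul_lintegral_le hn hK w hR
  have hm := hω.setAverage_pos w hR
  have hn0 : (0 : ℝ) < n := by positivity
  have hmeas : AEMeasurable (dualWeight ω) (volume.restrict (ball w R)) :=
    ((hω.integrableOn_ball w R).aemeasurable.pow_const n).inv
  refine ⟨hmeas.aestronglyMeasurable, ?_⟩
  rw [hasFiniteIntegral_iff_ofReal (Eventually.of_forall hω.dualWeight_nonneg)]
  by_contra htop
  rw [not_lt, top_le_iff] at htop
  rw [htop, ENNReal.top_div_of_ne_top measure_ball_lt_top.ne,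
    ENNReal.top_rpow_of_pos (by positivity), ENNReal.mul_top (by simpa using hm)] at h
  exact absurd h (by simp)

theorem IsMuckenhoupt.average_mul_le (hn : 1 ≤ n) (hK₀ : 0 ≤ K₀)
    (hω : IsMuckenhoupt (1 + 1 / (n : ℝ)) ω)
    (hK : muckenhouptConst (1 + 1 / (n : ℝ)) ω ≤ ENNReal.ofReal K₀) (w : Space n) (hR : 0 < R) :
    (⨍ x in ball w R, ω x) * (⨍ x in ball w R, dualWeight ω x) ^ (1 / (n : ℝ)) ≤ K₀ := by
  have h := hω.ofReal_average_mul_lintegral_le hn hK w hR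
  have hm := hω.setAverage_pos w hR
  rw [← ofReal_setAverage (hω.integrableOn_dualWeight hn hK w hR)
    (Eventually.of_forall hω.dualWeight_nonneg), ENNReal.ofReal_rpow_of_nonneg
    (hω.setAverage_dualWeight_nonneg w R) (by positivity), ← ENNReal.ofReal_mul hm.le] at h
  exact (ENNReal.ofReal_le_ofReal_iff hK₀).1 h

/-- The reverse of the Muckenhoupt bound, obtained by integrating n + 1 ≤ ns + s^{-n} at s = ω/m. It
turns a lower bound on T into one on mT/R². -/
theorem IsMuckenhoupt.one_le_average_mul (hn : 1 ≤ n)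
    (hω : IsMuckenhoupt (1 + 1 / (n : ℝ)) ω)
    (hK : muckenhouptConst (1 + 1 / (n : ℝ)) ω ≤ ENNReal.ofReal K₀) (w : Space n) (hR : 0 < R) :
    1 ≤ (⨍ x in ball w R, ω x) * (⨍ x in ball w R, dualWeight ω x) ^ (1 / (n : ℝ)) := by
  have hm := hω.setAverage_pos w hR
  have hi := hω.integrableOn_ball w R
  have hi' := hω.integrableOn_dualWeight hn hK w hR
  set m := ⨍ x in ball w R, ω x with hmdef
  set A := ⨍ x in ball w R, dualWeight ω x with hA
  have hA0 : 0 ≤ A := hω.setAverage_dualWeight_nonneg w R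
  have hvol : 0 < volume.real (ball w R) := ENNReal.toReal_pos
    (measure_ball_pos _ _ hR).ne' measure_ball_lt_top.ne
  -- Bernoulli's inequality for s⁻¹ combined with s + s⁻¹ ≥ 2.
  have hpt : ∀ s : ℝ, 0 < s → (n : ℝ) + 1 ≤ n * s + (s⁻¹) ^ n := by
    intro s hs
    have h1 : 1 + (n : ℝ) * (s⁻¹ - 1) ≤ (1 + (s⁻¹ - 1)) ^ n :=
      one_add_mul_le_pow (by have := inv_pos.2 hs; linarith) n
    rw [add_sub_cancel] at h1
    have h2 : 2 ≤ s + s⁻¹ := by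
      have : s + s⁻¹ - 2 = (s - 1) ^ 2 / s := by field_simp; ring
      have : 0 ≤ (s - 1) ^ 2 / s := by positivity
      linarith
    have h3 : (n : ℝ) * 2 ≤ n * (s + s⁻¹) := by gcongr
    linarith
  have hint : ∫ _x in ball w R, ((n : ℝ) + 1) ≤
      ∫ x in ball w R, (n / m * ω x + m ^ n * dualWeight ω x) := by
    refine integral_mono_ae (integrableOn_const measure_ball_lt_top.ne)
      ((hi.const_mul _).add (hi'.const_mul _)) ?_
    filter_upwards [ae_restrict_of_ae hω.pos_ae] with x hx
    refine (hpt (ω x / m) (by positivity)).trans_eq ?_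
    rw [dualWeight, inv_div, div_pow]
    ring
  rw [integral_add (hi.const_mul _) (hi'.const_mul _), integral_const_mul, integral_const_mul,
    setIntegral_const, smul_eq_mul] at hint
  have e1 : ∫ x in ball w R, ω x = volume.real (ball w R) * m := by
    rw [hmdef, setAverage_eq, smul_eq_mul, mul_inv_cancel_left₀ hvol.ne']
  have e2 : ∫ x in ball w R, dualWeight ω x = volume.real (ball w R) * A := by
    rw [hA, setAverage_eq, smul_eq_mul, mul_inv_cancel_left₀ hvol.ne']
  rw [e1, e2] at hint
  have h5 : 1 ≤ m ^ n * A := by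
    have h6 : volume.real (ball w R) * (n + 1) ≤ volume.real (ball w R) * (n + m ^ n * A) := by
      refine hint.trans_eq ?_
      field_simp
    have := le_of_mul_le_mul_left h6 hvol
    linarith
  have h7 : m * A ^ (1 / (n : ℝ)) = (m ^ n * A) ^ (1 / (n : ℝ)) := by
    rw [Real.mul_rpow (by positivity) hA0, one_div, Real.pow_rpow_inv_natCast hm.le (by omega)]
  rw [h7]
  exact Real.one_le_rpow h5 (by positivity)

theorem IsMuckenhoupt.lintegral_oscillation_le {p ε : ℝ} (hω : IsMuckenhoupt p ω) (hε : 0 ≤ ε)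
    (hR : 0 < R) (hosc : meanOsc ω ω w R ≤ ENNReal.ofReal ε) :
    ∫⁻ x in ball w R, ENNReal.ofReal (|ω x - ⨍ x' in ball w R, ω x'| ^ (n + 1) / ω x ^ n) ≤
      ENNReal.ofReal (ε ^ (n + 1) * ⨍ x in ball w R, ω x) * volume (ball w R) := by
  have hvol0 : volume (ball w R) ≠ 0 := (measure_ball_pos _ _ hR).ne'
  have hI := ofReal_setAverage (hω.integrableOn_ball w R) (Eventually.of_forall hω.nonneg)
  have hm := hω.setAverage_pos w hR
  set m := ⨍ x in ball w R, ω x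
  set I := ∫⁻ x in ball w R, ENNReal.ofReal (ω x)
  have hI' : ENNReal.ofReal m * volume (ball w R) = I := by
    rw [hI, ENNReal.div_mul_cancel hvol0 measure_ball_lt_top.ne]
  have hI0 : I ≠ 0 := by
    rw [← hI']; exact mul_ne_zero (by simpa using hm) hvol0
  have hIt : I ≠ ∞ := by
    rw [← hI']; exact ENNReal.mul_ne_top ENNReal.ofReal_ne_top measure_ball_lt_top.ne
  have hQ : ∫⁻ x in ball w R, ENNReal.ofReal (|ω x - m| ^ (n + 1) / ω x ^ n) =
      ∫⁻ x in ball w R, ENNReal.ofReal |ω x - m| ^ (n + 1) * ENNReal.ofReal (ω x) ^ (-(n : ℝ)) := by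
    refine lintegral_congr_ae ?_
    filter_upwards [ae_restrict_of_ae hω.pos_ae] with x hx
    rw [ofReal_rpow_neg_natCast hx, div_eq_mul_inv, ENNReal.ofReal_mul (by positivity),
      ENNReal.ofReal_pow (abs_nonneg _)]
  rw [hQ, ENNReal.ofReal_mul (by positivity), mul_assoc, hI', ← ENNReal.div_le_iff hI0 hIt]
  have h1 := ENNReal.rpow_le_rpow hosc (z := (n : ℝ) + 1) (by positivity)
  rw [meanOsc, ← ENNReal.rpow_mul, one_div_mul_cancel (by positivity), ENNReal.rpow_one,
    ENNReal.ofReal_rpow_of_nonneg hε (by positivity)] at h1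
  exact_mod_cast h1

end Weights

/-! ### Propagation of positivity in one step -/

section OneStep

variable {n : ℕ}

theorem HasHessianOn.sub_const {f : Space n → ℝ} {G : Space n → Space n}
    {H : Space n → Space n →L[ℝ] Space n} {U : Set (Space n)} (hf : HasHessianOn f G H U) (c : ℝ) :
    HasHessianOn (fun x => f x - c) G H U :=
  ⟨fun x hx => (hf.grad x hx).sub_const c, hf.hess, hf.cont⟩

theorem IsElliptic.mono {ν : ℝ} {a : SpaceTime n → Matrix (Fin n) (Fin n) ℝ}
    {Ω Ω' : Set (SpaceTime n)} (h : IsElliptic ν a Ω) (hΩ : Ω' ⊆ Ω) : IsElliptic ν a Ω' :=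
  ⟨fun i j => (h.aemeasurable i j).mono_set hΩ, fun X hX => h.symm X (hΩ hX),
    fun X hX => h.lower X (hΩ hX), fun X hX => h.upper X (hΩ hX)⟩

theorem IsC21On.mono {u : SpaceTime n → ℝ} {Ω Ω' : Set (SpaceTime n)} (h : IsC21On u Ω)
    (hΩ : Ω' ⊆ Ω) : IsC21On u Ω' :=
  ⟨h.continuousOn.mono hΩ, fun X hX => h.time_diff X (hΩ hX), h.time_cont.mono hΩ,
    fun i X hX => h.space_diff i X (hΩ hX), fun i => (h.space_cont i).mono hΩ,
    fun i j X hX => h.space2_diff i j X (hΩ hX), fun i j => (h.space2_cont i j).mono hΩ⟩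

theorem norm_sub_add_le_of_ball_subset (hn : 1 ≤ n) {z w : Space n} {ρ R : ℝ} (hρ : 0 < ρ)
    (h : ball z ρ ⊆ ball w R) : ‖z - w‖ + ρ ≤ R := by
  -- A unit vector pointing from w to z; if z = w any direction serves, and this needs n ≥ 1.
  obtain ⟨e, he, hze⟩ : ∃ e : Space n, ‖e‖ = 1 ∧ z - w = ‖z - w‖ • e := by
    by_cases hzw : z - w = 0
    · exact ⟨EuclideanSpace.single ⟨0, hn⟩ 1, by simp, by simp [hzw]⟩
    · have := norm_pos_iff.2 hzw
      refine ⟨‖z - w‖⁻¹ • (z - w), ?_, ?_⟩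
      · rw [norm_smul, norm_inv, norm_norm, inv_mul_cancel₀ this.ne']
      · rw [smul_smul, mul_inv_cancel₀ this.ne', one_smul]
  have key : ∀ s : ℝ, 0 < s → s < ρ → ‖z - w‖ + s < R := by
    intro s hs hsρ
    have h1 : z + s • e ∈ ball w R := h (by simpa [norm_smul, he, abs_of_pos hs] using hsρ)
    have h2 : z + s • e - w = (‖z - w‖ + s) • e := by
      rw [add_smul, ← hze]; abel
    rw [mem_ball, dist_eq_norm, h2, norm_smul, he, mul_one,
      Real.norm_of_nonneg (by positivity)] at h1
    exact h1
  by_contra! hcon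
  have hs := key (max (ρ / 2) (R - ‖z - w‖)) (lt_max_of_lt_left (half_pos hρ))
    (max_lt (by linarith) (by linarith))
  linarith [le_max_right (ρ / 2) (R - ‖z - w‖)]

/-- Both sides scale like M^{n+1}/R^n, and mT/R² ≤ K₀ removes the remaining dependence on scale.
Here 122880 = 4096 · 30, and 4 · 12^n collects the 2^n of the density with the 4 · 6^n of the cone.
-/
theorem abp_smallness {ν K₀ c ε M R T m : ℝ} (hn : 1 ≤ n) (hν : 0 < ν) (hν1 : ν < 1)
    (hK₀ : 1 ≤ K₀) (hc : 0 < c) (hM : 0 < M) (hR : 0 < R) (hT : 0 < T) (hm : 0 < m)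
    (hX : m * T / R ^ 2 ≤ K₀)
    (hε : ε = c / (2 * (122880 * n ^ 2 * ν⁻¹) * (4 * 12 ^ n / ν ^ n * K₀))) :
    T * (2 ^ n / ν ^ n * (M * 4096 / R ^ 6 * (30 * n ^ 2 * ν⁻¹ * R ^ 4)) ^ (n + 1) *
      (ε ^ (n + 1) * m * R ^ n)) < (c * M / (8 * (3 * R / 4))) ^ n * (c * M / 4) := by
  have hn0 : (0 : ℝ) < n := by positivity
  set C₂ := 4 * 12 ^ n / ν ^ n * K₀ with hC₂
  have hC₂1 : 1 ≤ C₂ := by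
    have h1 : ν ^ n ≤ 1 := pow_le_one₀ hν.le hν1.le
    have h2 : (1 : ℝ) ≤ 12 ^ n := one_le_pow₀ (by norm_num)
    have h3 : 1 ≤ 4 * 12 ^ n / ν ^ n := by
      rw [le_div_iff₀ (by positivity)]; linarith
    nlinarith
  have hC₂0 : 0 < C₂ := by linarith
  have hDε : 122880 * n ^ 2 * ν⁻¹ * ε = c / (2 * C₂) := by
    rw [hε]; field_simp
  have hlhs : T * (2 ^ n / ν ^ n * (M * 4096 / R ^ 6 * (30 * n ^ 2 * ν⁻¹ * R ^ 4)) ^ (n + 1) *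
      (ε ^ (n + 1) * m * R ^ n)) = m * T / R ^ 2 * (2 ^ n / ν ^ n) *
        (c / (2 * C₂)) ^ (n + 1) * M ^ (n + 1) / R ^ n := by
    have e1 : M * 4096 / R ^ 6 * (30 * n ^ 2 * ν⁻¹ * R ^ 4) = 122880 * n ^ 2 * ν⁻¹ * M / R ^ 2 := by
      field_simp; ring
    rw [e1, ← hDε, div_pow, mul_pow, mul_pow _ ε, pow_succ (R ^ 2)]
    field_simp
    ring
  have hrhs : (c * M / (8 * (3 * R / 4))) ^ n * (c * M / 4) =
      c ^ (n + 1) * M ^ (n + 1) / (4 * 6 ^ n) / R ^ n := by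
    rw [show 8 * (3 * R / 4) = 6 * R by ring, div_pow, mul_pow c M n, mul_pow 6 R]
    field_simp
    ring
  rw [hlhs, hrhs]
  refine div_lt_div_of_pos_right ?_ (by positivity)
  have h4 : (1 / (2 * C₂)) ^ (n + 1) * C₂ ≤ (1 / 2) ^ (n + 1) := by
    rw [one_div_pow, mul_pow, one_div_pow]
    rw [div_mul_eq_mul_div, one_mul, div_le_div_iff₀ (by positivity) (by positivity), one_mul]
    have : C₂ ≤ C₂ ^ (n + 1) := le_self_pow₀ hC₂1 (by omega)
    nlinarith [pow_pos (zero_lt_two' ℝ) (n + 1)]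
  have h5 : (1 / 2 : ℝ) ^ (n + 1) < 1 := pow_lt_one₀ (by norm_num) (by norm_num) (by omega)
  have h6 : (2 : ℝ) ^ n * (4 * 6 ^ n) = 4 * 12 ^ n := by
    rw [mul_left_comm, ← mul_pow]; norm_num
  calc m * T / R ^ 2 * (2 ^ n / ν ^ n) * (c / (2 * C₂)) ^ (n + 1) * M ^ (n + 1)
      ≤ K₀ * (2 ^ n / ν ^ n) * (c / (2 * C₂)) ^ (n + 1) * M ^ (n + 1) := by gcongr
    _ = ((1 / (2 * C₂)) ^ (n + 1) * C₂) * (c ^ (n + 1) * M ^ (n + 1) / (4 * 6 ^ n)) := by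
        have : C₂ = 2 ^ n / ν ^ n * (4 * 6 ^ n) * K₀ := by rw [hC₂, ← h6]; ring
        rw [div_pow, one_div_pow]
        conv_rhs => rw [mul_assoc]; arg 2; rw [this]
        field_simp
    _ < 1 * (c ^ (n + 1) * M ^ (n + 1) / (4 * 6 ^ n)) := by
        refine mul_lt_mul_of_pos_right (h4.trans_lt h5) (by positivity)
    _ = _ := one_mul _

theorem lintegral_source_le {p ε D C R R' : ℝ} {w : Space n} {ω : Space n → ℝ}
    (hω : IsMuckenhoupt p ω) (hε : 0 ≤ ε) (hC : 0 ≤ C) (hD : 0 ≤ D) (hR : 0 < R) (hn : 1 ≤ n)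
    (hR' : R' < R) (hosc : meanOsc ω ω w R ≤ ENNReal.ofReal ε) :
    ∫⁻ x in closedBall w R', ENNReal.ofReal
      (C * ((D * |ω x - ⨍ x' in ball w R, ω x'|) ^ (n + 1) / ω x ^ n)) ≤
      ENNReal.ofReal (C * D ^ (n + 1) * (ε ^ (n + 1) * (⨍ x in ball w R, ω x) * R ^ n)) *
        volume (ball (0 : Space n) 1) := by
  have : Nonempty (Fin n) := ⟨⟨0, hn⟩⟩
  have h1 := hω.lintegral_oscillation_le hε hR hosc
  have hm := hω.setAverage_pos w hR
  set m := ⨍ x in ball w R, ω x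
  calc _ ≤ ∫⁻ x in ball w R, ENNReal.ofReal (C * ((D * |ω x - m|) ^ (n + 1) / ω x ^ n)) :=
        lintegral_mono_set (closedBall_subset_ball hR')
    _ = ∫⁻ x in ball w R, ENNReal.ofReal (C * D ^ (n + 1)) *
          ENNReal.ofReal (|ω x - m| ^ (n + 1) / ω x ^ n) := by
        refine lintegral_congr fun x => ?_
        rw [← ENNReal.ofReal_mul (by positivity), mul_pow]
        congr 1
        ring
    _ = ENNReal.ofReal (C * D ^ (n + 1)) *
          ∫⁻ x in ball w R, ENNReal.ofReal (|ω x - m| ^ (n + 1) / ω x ^ n) :=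
        lintegral_const_mul' _ _ ENNReal.ofReal_ne_top
    _ ≤ ENNReal.ofReal (C * D ^ (n + 1)) * (ENNReal.ofReal (ε ^ (n + 1) * m) *
          volume (ball w R)) := by gcongr
    _ = _ := by
        rw [Measure.addHaar_ball volume w hR.le]
        simp only [finrank_euclideanSpace, Fintype.card_fin]
        rw [← mul_assoc, ← mul_assoc, ← ENNReal.ofReal_mul (by positivity),
          ← ENNReal.ofReal_mul (by positivity)]
        congr 2
        ring

end OneStep

/-! ### Comparison of the solution with the barrier -/

section OneStep

variable {n : ℕ}

/-- If ψ - u exceeded cM, the planes below that height would fill a cone whose volume contradicts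
the bound by the oscillation of ω. Times strictly inside the interval are used, since u has
derivatives only in the open cylinder. -/
theorem barrier_sub_le {p ν K₀ c ε M R T t₀ : ℝ} {z w : Space n} {ω : Space n → ℝ}
    {a : SpaceTime n → Matrix (Fin n) (Fin n) ℝ} {u : SpaceTime n → ℝ}
    (hn : 1 ≤ n) (hν : 0 < ν) (hν1 : ν < 1) (hK₀ : 1 ≤ K₀) (hc : 0 < c) (hM : 0 < M) (hR : 0 < R)
    (hT : 0 < T) (hω : IsMuckenhoupt p ω) (hμ : IntegrableOn (dualWeight ω) (ball w R))
    (hX : (⨍ x in ball w R, ω x) * T / R ^ 2 ≤ K₀)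
    (hε : ε = c / (2 * (122880 * n ^ 2 * ν⁻¹) * (4 * 12 ^ n / ν ^ n * K₀)))
    (hosc : meanOsc ω ω w R ≤ ENNReal.ofReal ε)
    (hell : IsElliptic ν a (ball w R ×ˢ Ioo t₀ (t₀ + T)))
    (hu : IsC21On u (ball w R ×ˢ Ioo t₀ (t₀ + T)))
    (huc : ContinuousOn u (closedBall w (3 * R / 4) ×ˢ Icc t₀ (t₀ + T)))
    (hu0 : ∀ X ∈ closedBall w (3 * R / 4) ×ˢ Icc t₀ (t₀ + T), 0 ≤ u X)
    (hpde : ∀ᵐ X ∂(volume.restrict (ball w R ×ˢ Ioo t₀ (t₀ + T))), 0 ≤ parabolicOp ω a u X)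
    (hzw : ‖w - z‖ ≤ R / 2) (hinit : ∀ x ∈ ball z (R / 4), M ≤ u (x, t₀))
    {t : ℝ} (ht : t ∈ Ioo t₀ (t₀ + T)) {x : Space n} (hx : x ∈ closedBall w (3 * R / 4)) :
    barrier z w R t₀ T (barrierRate n R T ν (⨍ x in ball w R, ω x)) (M * 4096 / R ^ 6) x t -
      u (x, t) ≤ c * M := by
  have hm := hω.setAverage_pos w hR
  set m := ⨍ x in ball w R, ω x with hmdef
  set q := barrierRate n R T ν m with hq
  have hq0 : 0 ≤ q := barrierRate_nonneg hν hm
  -- Since 4096 = 4⁶, this gives Λ (R/4)⁶ = M, the largest initial value of the barrier.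
  set Λ := M * 4096 / R ^ 6 with hΛ
  have hΛ0 : 0 < Λ := by positivity
  set R' := 3 * R / 4 with hR'
  have hR'0 : 0 < R' := by positivity
  have hR'R : R' < R := by linarith
  have hε0 : 0 ≤ ε := by rw [hε]; positivity
  set ψ := barrier z w R t₀ T q Λ with hψ
  by_contra! hcon
  -- The excess is spent twice: subtracting it makes ψ - u - η nonpositive at a time s slightly
  -- after t₀, and ψ - u - η > -η forces ψ > u ≥ 0, so the point lies in the moving ball.
  set η := (ψ x t - u (x, t) - c * M) with hη
  have hη0 : 0 < η := by linarith
  have hKc : IsCompact (closedBall w R' ×ˢ Icc t₀ (t₀ + T)) :=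
    (isCompact_closedBall w R').prod isCompact_Icc
  have hψc : Continuous fun X : Space n × ℝ => ψ X.1 X.2 := continuous_barrier z w R t₀ T q Λ
  have hφc : ContinuousOn (fun X : Space n × ℝ => ψ X.1 X.2 - u X)
    (closedBall w R' ×ˢ Icc t₀ (t₀ + T)) := hψc.continuousOn.sub huc
  have hφ0 : ∀ x ∈ closedBall w R', ψ x t₀ - u (x, t₀) ≤ 0 := by
    intro x hx
    have hux := hu0 (x, t₀) ⟨hx, le_rfl, by linarith⟩
    simp only [hψ, barrier, movingBall_initial, sub_self, mul_zero, neg_zero, Real.exp_zero,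
      mul_one]
    by_cases hxz : x ∈ ball z (R / 4)
    · have h1 := hinit x hxz
      have h2 : (R / 4) ^ 2 - ‖x - z‖ ^ 2 ≤ (R / 4) ^ 2 := by linarith [sq_nonneg ‖x - z‖]
      have h3 : ‖x - z‖ ^ 2 ≤ (R / 4) ^ 2 := by
        rw [mem_ball, dist_eq_norm] at hxz
        gcongr
      have h4 : ((R / 4) ^ 2 - ‖x - z‖ ^ 2) ^ 3 ≤ ((R / 4) ^ 2) ^ 3 :=
        pow_le_pow_left₀ (by linarith) h2 3
      have h5 : Λ * ((R / 4) ^ 2) ^ 3 = M := by rw [hΛ]; field_simp; norm_num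
      have h6 := mul_le_mul_of_nonneg_left h4 hΛ0.le
      linarith
    · have h3 : (R / 4) ^ 2 ≤ ‖x - z‖ ^ 2 := by
        rw [mem_ball, dist_eq_norm, not_lt] at hxz
        gcongr
      have h4 : ((R / 4) ^ 2 - ‖x - z‖ ^ 2) ^ 3 ≤ 0 := by
        have := Odd.pow_nonpos (n := 3) (by decide) (sub_nonpos.2 h3)
        exact this
      have := mul_nonpos_of_nonneg_of_nonpos hΛ0.le h4
      linarith
  obtain ⟨δ, hδ, hunif⟩ := Metric.uniformContinuousOn_iff.1
    (hKc.uniformContinuousOn_of_continuous hφc) η hη0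
  obtain ⟨s, hs0, hst, hsδ⟩ : ∃ s, t₀ < s ∧ s < t ∧ s - t₀ < δ := by
    obtain ⟨s, hs1, hs2⟩ := exists_between (lt_min ht.1 (show t₀ < t₀ + δ by linarith))
    exact ⟨s, hs1, hs2.trans_le (min_le_left _ _), by linarith [min_le_right t (t₀ + δ)]⟩
  have hIcc : Icc s t ⊆ Ioo t₀ (t₀ + T) := fun τ hτ => ⟨hs0.trans_le hτ.1, hτ.2.trans_lt ht.2⟩
  have hIcc' : Icc s t ⊆ Icc t₀ (t₀ + T) := hIcc.trans Ioo_subset_Icc_self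
  have hKΩ : closedBall w R' ×ˢ Icc s t ⊆ ball w R ×ˢ Ioo t₀ (t₀ + T) :=
    prod_mono (closedBall_subset_ball hR'R) hIcc
  have hKK : closedBall w R' ×ˢ Icc s t ⊆ closedBall w R' ×ˢ Icc t₀ (t₀ + T) :=
    prod_mono le_rfl hIcc'
  set v : Space n → ℝ → ℝ := fun x t => 1 * ψ x t + -1 * u (x, t) - η with hv
  have hball : closedBall w R' ⊆ ball w R := closedBall_subset_ball hR'R
  set f : Space n → ℝ := fun x => Λ * (30 * n ^ 2 * ν⁻¹ * R ^ 4) * |ω x - m| with hf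
  have hωi := hω.integrableOn_ball w R
  have hD0 : 0 ≤ Λ * (30 * n ^ 2 * ν⁻¹ * R ^ 4) := by positivity
  have hvol := volume_le_of_subsolution (U := ball w R) (R := R') (w := w) (t₀ := s) (t₁ := t)
    (v := v) (vt := fun x t => barrierDeriv z w R t₀ T q Λ x t - timeDeriv u (x, t))
    (G := fun x t => (1 : ℝ) • barrierGrad z w R t₀ T q Λ x t + (-1 : ℝ) • spaceGrad u x t)
    (H := fun x t => (1 : ℝ) • barrierHess z w R t₀ T q Λ x t + (-1 : ℝ) • spaceHess u x t)
    (ν := ν) (η₀ := η) (M := c * M) (ω := ω) (f := f) (a := a)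
    isOpen_ball hR'0 hball hst
    (fun τ hτ => ((hasHessianOn_barrier z w R t₀ T q Λ τ _).combo
      (hu.hasHessianOn isOpen_ball fun x hx => ⟨hx, hIcc hτ⟩) 1 (-1)).sub_const η)
    (fun x hx τ hτ => by
      have h1 := hasDerivAt_barrier z w R t₀ T q Λ x τ
      have h2 := hasDerivAt_time (hu.time_diff (x, τ) ⟨hball hx, hIcc hτ⟩)
      refine (((h1.const_mul 1).add (h2.const_mul (-1))).sub_const η).congr_deriv ?_
      ring)
    ((((continuousOn_const.mul hψc.continuousOn).add
      (continuousOn_const.mul (huc.mono hKK)))).sub continuousOn_const)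
    ((continuous_barrierDeriv z w R t₀ T q Λ).continuousOn.sub (hu.time_cont.mono hKΩ))
    (((continuous_barrierHess z w R t₀ T q Λ).continuousOn.const_smul (1 : ℝ)).add
      ((hu.continuousOn_spaceHess.mono hKΩ).const_smul (-1 : ℝ)))
    (fun x hx τ hτ => by
      have h1 : movingBall z w R t₀ T x τ ≤ 0 := movingBall_nonpos hR hT hzw (hIcc' hτ) (by
        rw [← dist_eq_norm]; exact (mem_sphere.1 hx).ge)
      have h2 : ψ x τ ≤ 0 := mul_nonpos_of_nonneg_of_nonpos (by positivity)
        (Odd.pow_nonpos (by decide) h1)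
      have h3 := hu0 (x, τ) ⟨sphere_subset_closedBall hx, hIcc' hτ⟩
      simp only [hv]
      linarith)
    (fun x hx => by
      have h1 := hunif (x, s) ⟨hx, hs0.le, (hst.trans ht.2).le⟩ (x, t₀) ⟨hx, le_rfl, by linarith⟩
        (by
          rw [Prod.dist_eq, dist_self, Real.dist_eq, abs_of_pos (sub_pos.2 hs0)]
          exact max_lt hδ hsδ)
      rw [Real.dist_eq] at h1
      have h2 := (abs_lt.1 h1).2
      have h3 := hφ0 x hx
      simp only [hv]
      linarith)
    hν hω.pos_ae (hωi.mono_set hball) (hμ.mono_set hball)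
    (fun x => mul_nonneg hD0 (abs_nonneg _))
    ((((hωi.mono_set hball).aemeasurable.sub_const m).abs).const_mul _)
    (fun X hX => hell.lower X (hKΩ hX)) (fun X hX => hell.upper X (hKΩ hX)) hη0
    (by
      filter_upwards [ae_restrict_of_ae_restrict_of_subset hKΩ hpde, ae_restrict_mem
        (measurableSet_closedBall.prod measurableSet_Icc)] with ⟨x, τ⟩ hpx hX hvx
      have hXΩ := hKΩ hX
      have hux := hu0 _ (hKK hX)
      simp only [hv] at hvx
      have hψpos : 0 < ψ x τ := by linarith
      have hg : 0 < movingBall z w R t₀ T x τ := by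
        by_contra! h1
        have h2 : ψ x τ ≤ 0 := mul_nonpos_of_nonneg_of_nonpos (by positivity)
          (Odd.pow_nonpos (by decide) h1)
        linarith
      have hI := hIcc' hX.2
      have h1 := barrier_subsolution (ν := ν) hR hT hν hm hΛ0.le hzw (hell.lower _ hXΩ)
        (hell.upper _ hXΩ) hI hg
      have h2 := abs_sum_barrierHess_le (q := q) hR hT hν hΛ0.le hq0 hzw (hell.upper _ hXΩ) hI hg
      have hsum : ∑ i, ∑ j, a (x, τ) i j * hessianMatrix ((1 : ℝ) • barrierHess z w R t₀ T q Λ x τ +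
          (-1 : ℝ) • spaceHess u x τ) i j =
          ∑ i, ∑ j, a (x, τ) i j * hessianMatrix (barrierHess z w R t₀ T q Λ x τ) i j -
          ∑ i, ∑ j, a (x, τ) i j * spaceDeriv i (spaceDeriv j u) (x, τ) := by
        simp only [← Finset.sum_sub_distrib]
        refine Finset.sum_congr rfl fun i _ => Finset.sum_congr rfl fun j _ => ?_
        rw [← hessianMatrix_spaceHess, ← mul_sub]
        congr 1
        simp [hessianMatrix, sub_eq_add_neg]
      simp only [hf, hsum]
      simp only [parabolicOp] at hpx
      set S := ∑ i, ∑ j, a (x, τ) i j * hessianMatrix (barrierHess z w R t₀ T q Λ x τ) i j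
      have h3 : -((ω x - m) * S) ≤ Λ * (30 * n ^ 2 * ν⁻¹ * R ^ 4) * |ω x - m| := by
        refine (neg_le_abs _).trans ?_
        rw [abs_mul, mul_comm]
        exact mul_le_mul_of_nonneg_right h2 (abs_nonneg _)
      have h4 : barrierDeriv z w R t₀ T q Λ x τ - m * S ≤ 0 := h1
      linarith)
    ⟨x, hx, by simp only [hv]; linarith⟩
  have hlow := (volume_cone_ge hn hR'0 (mul_pos hc hM)).trans hvol
  have hsrc := lintegral_source_le (w := w) (R' := R') hω hε0
    (by positivity : (0 : ℝ) ≤ 2 ^ n / ν ^ n) hD0 hR hn hR'R hosc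
  have hB0 : volume (ball (0 : Space n) 1) ≠ 0 := (measure_ball_pos _ _ one_pos).ne'
  have h5 := hlow.trans (mul_le_mul' (ENNReal.ofReal_le_ofReal
    (show t - s ≤ T by linarith [ht.2])) hsrc)
  rw [← mul_assoc, ENNReal.mul_le_mul_iff_left hB0 measure_ball_lt_top.ne,
    ← ENNReal.ofReal_mul hT.le, ENNReal.ofReal_le_ofReal_iff (by positivity)] at h5
  have h6 := abp_smallness hn hν hν1 hK₀ hc hM hR hT hm hX hε
  exact absurd h5 (not_le.2 h6)

/-- Propagation of positivity from a ball to a ball of at most twice its radius. -/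
theorem exists_one_step (hn : 1 ≤ n) {ν K₀ κ : ℝ} (hν : 0 < ν) (hν1 : ν < 1) (hK₀ : 1 ≤ K₀)
    (hκ : 0 < κ) :
    ∃ c ε : ℝ, 0 < c ∧ c < 1 ∧ 0 < ε ∧ ε < 1 ∧
      ∀ (ω : Space n → ℝ) (a : SpaceTime n → Matrix (Fin n) (Fin n) ℝ) (u : SpaceTime n → ℝ)
        (z w : Space n) (R T t₀ ρ M : ℝ), 0 < R → IsMuckenhoupt (1 + 1 / (n : ℝ)) ω →
        muckenhouptConst (1 + 1 / (n : ℝ)) ω ≤ ENNReal.ofReal K₀ →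
        meanOsc ω ω w R ≤ ENNReal.ofReal ε → 0 < T →
        κ * cylinderHeight (dualWeight ω) R w ≤ T → T ≤ cylinderHeight (dualWeight ω) R w →
        IsElliptic ν a (ball w R ×ˢ Ioo t₀ (t₀ + T)) →
        IsC21On u (ball w R ×ˢ Ioo t₀ (t₀ + T)) →
        ContinuousOn u (closedBall w (3 * R / 4) ×ˢ Icc t₀ (t₀ + T)) →
        (∀ X ∈ closedBall w (3 * R / 4) ×ˢ Icc t₀ (t₀ + T), 0 ≤ u X) →
        (∀ᵐ X ∂(volume.restrict (ball w R ×ˢ Ioo t₀ (t₀ + T))), 0 ≤ parabolicOp ω a u X) →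
        R / 2 ≤ ρ → ball z ρ ⊆ ball w R → 0 ≤ M → (∀ x ∈ ball z (ρ / 2), M ≤ u (x, t₀)) →
        ∀ x ∈ ball w (R / 2), c * M ≤ u (x, t₀ + T) := by
  set Q := K₀ / (6 * ν) * (9 / (2 * κ) + 6 * n / ν + 24 * ν) ^ 2 with hQ
  have hQ0 : 0 ≤ Q := by positivity
  -- Q bounds the total decay exponent. The final barrier is at least 64 exp(-Q) M on B_{R/2}(w),
  -- well above the 2cM needed to absorb the error cM.
  set c := Real.exp (-Q) / 2 with hc
  have hc0 : 0 < c := by positivity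
  have hc1 : c < 1 := by
    have : Real.exp (-Q) ≤ 1 := Real.exp_le_one_iff.2 (by linarith)
    rw [hc]; linarith
  set ε := c / (2 * (122880 * n ^ 2 * ν⁻¹) * (4 * 12 ^ n / ν ^ n * K₀)) with hε
  have hn1 : (1 : ℝ) ≤ n := by exact_mod_cast hn
  refine ⟨c, ε, hc0, hc1, by positivity, ?_, ?_⟩
  · have h1 : (1 : ℝ) ≤ ν⁻¹ := (one_le_inv₀ hν).2 hν1.le
    have h2 : (1 : ℝ) ≤ 4 * 12 ^ n / ν ^ n := by
      rw [le_div_iff₀ (by positivity), one_mul]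
      have h3 : ν ^ n ≤ 1 := pow_le_one₀ hν.le hν1.le
      have h4 : (1 : ℝ) ≤ 12 ^ n := one_le_pow₀ (by norm_num)
      linarith
    have h5 : (1 : ℝ) ≤ n ^ 2 := one_le_pow₀ hn1
    have h6 : (1 : ℝ) ≤ n ^ 2 * ν⁻¹ := one_le_mul_of_one_le_of_one_le h5 h1
    have h7 : (1 : ℝ) ≤ 4 * 12 ^ n / ν ^ n * K₀ := one_le_mul_of_one_le_of_one_le h2 hK₀
    have h8 : (1 : ℝ) ≤ 2 * (122880 * n ^ 2 * ν⁻¹) := by linarith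
    rw [hε, div_lt_one (by positivity)]
    exact hc1.trans_le (one_le_mul_of_one_le_of_one_le h8 h7)
  · intro ω a u z w R T t₀ ρ M hR hω hconst hosc hT hκT hTH hell hu huc hu0 hpde hρ hsub hM hinit
      x hx
    have hxK : x ∈ closedBall w (3 * R / 4) :=
      (ball_subset_closedBall.trans (closedBall_subset_closedBall (by linarith))) hx
    rcases hM.eq_or_lt with rfl | hM0
    · rw [mul_zero]
      exact hu0 _ ⟨hxK, by linarith, le_rfl⟩
    have hm := hω.setAverage_pos w hR
    have hk1 := hω.one_le_average_mul hn hconst w hR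
    have hk2 := hω.average_mul_le hn (by linarith) hconst w hR
    set m := ⨍ x in ball w R, ω x with hmdef
    rw [cylinderHeight] at hκT hTH
    set k := (⨍ x in ball w R, dualWeight ω x) ^ (1 / (n : ℝ)) with hk
    have hX1 : κ ≤ m * T / R ^ 2 := by
      rw [le_div_iff₀ (by positivity)]
      have h1 := mul_le_mul_of_nonneg_left hκT hm.le
      have h2 : κ * R ^ 2 * 1 ≤ κ * R ^ 2 * (m * k) := by gcongr
      linarith
    have hX2 : m * T / R ^ 2 ≤ K₀ := by
      rw [div_le_iff₀ (by positivity)]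
      have h1 := mul_le_mul_of_nonneg_left hTH hm.le
      have h2 : R ^ 2 * (m * k) ≤ R ^ 2 * K₀ := by gcongr
      linarith
    have hρ0 : 0 < ρ := by linarith
    have hzw : ‖w - z‖ ≤ R / 2 := by
      have := norm_sub_add_le_of_ball_subset hn hρ0 hsub
      rw [norm_sub_rev]; linarith
    have hinit' : ∀ x ∈ ball z (R / 4), M ≤ u (x, t₀) := fun x hx =>
      hinit x (ball_subset_ball (by linarith) hx)
    set Λ := M * 4096 / R ^ 6 with hΛ
    have hΛ0 : 0 < Λ := by positivity
    set q := barrierRate n R T ν m with hq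
    have hle : ∀ t ∈ Ioo t₀ (t₀ + T), barrier z w R t₀ T q Λ x t - u (x, t) ≤ c * M :=
      fun t ht => barrier_sub_le hn hν hν1 hK₀ hc0 hM0 hR hT hω
        (hω.integrableOn_dualWeight hn hconst w hR) hX2 hε hosc hell hu huc hu0 hpde hzw hinit'
        ht hxK
    -- The comparison holds at interior times only and reaches the final time by continuity.
    have hfin : barrier z w R t₀ T q Λ x (t₀ + T) - u (x, t₀ + T) ≤ c * M := by
      have h1 : ContinuousWithinAt (fun t => barrier z w R t₀ T q Λ x t - u (x, t))
          (Icc t₀ (t₀ + T)) (t₀ + T) := by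
        refine ContinuousWithinAt.sub ?_ ?_
        · exact (hasDerivAt_barrier z w R t₀ T q Λ x _).continuousAt.continuousWithinAt
        · have h2 : ContinuousOn (fun t : ℝ => u (x, t)) (Icc t₀ (t₀ + T)) :=
            huc.comp (by fun_prop) fun t ht => ⟨hxK, ht⟩
          exact h2 _ (right_mem_Icc.2 (by linarith))
      have h3 := h1.mono Ioo_subset_Icc_self
      have : (𝓝[Ioo t₀ (t₀ + T)] (t₀ + T)).NeBot := right_nhdsWithin_Ioo_neBot (by linarith)
      exact le_of_tendsto h3 (eventually_of_mem self_mem_nhdsWithin hle)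
    have hψ : 2 * c * M ≤ barrier z w R t₀ T q Λ x (t₀ + T) := by
      rw [barrier, movingBall_final hT.ne', add_sub_cancel_left]
      have h1 : (R / 2) ^ 2 ≤ (3 * R / 4) ^ 2 - ‖x - w‖ ^ 2 := by
        rw [mem_ball, dist_eq_norm] at hx
        have : ‖x - w‖ ^ 2 ≤ (R / 2) ^ 2 := by gcongr
        nlinarith [sq_nonneg R]
      have h2 : ((R / 2) ^ 2) ^ 3 ≤ ((3 * R / 4) ^ 2 - ‖x - w‖ ^ 2) ^ 3 :=
        pow_le_pow_left₀ (by positivity) h1 3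
      have h3 : q * T ≤ Q := barrierRate_mul_le hR hT hν hm hκ hX1 hX2
      have h4 : Real.exp (-Q) ≤ Real.exp (-(q * T)) := Real.exp_le_exp.2 (by linarith)
      calc 2 * c * M ≤ Λ * Real.exp (-Q) * ((R / 2) ^ 2) ^ 3 := by
            have : Λ * Real.exp (-Q) * ((R / 2) ^ 2) ^ 3 = 64 * (Real.exp (-Q) * M) := by
              rw [hΛ]; field_simp; norm_num
            rw [this, hc]
            have : 0 < Real.exp (-Q) * M := by positivity
            linarith
        _ ≤ _ := by gcongr
    linarith

end OneStep

/-! ### Propagation of positivity through a chain of balls -/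

section Chain

variable {n : ℕ}

/-- As |B_R| = R^n |B_1|, the height is R (∫_{B_R} μ / |B_1|)^{1/n}, and the integral is monotone
under inclusion. -/
theorem cylinderHeight_le (hn : 1 ≤ n) {μ : Space n → ℝ} (hμ : ∀ x, 0 ≤ μ x) {w y : Space n}
    {R r : ℝ} (hR : 0 < R) (hr : 0 < r) (hμi : IntegrableOn μ (ball y r))
    (hsub : ball w R ⊆ ball y r) : cylinderHeight μ R w ≤ R / r * cylinderHeight μ r y := by
  have : Nonempty (Fin n) := ⟨⟨0, hn⟩⟩
  have hV : 0 < volume.real (ball (0 : Space n) 1) := ENNReal.toReal_pos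
    (measure_ball_pos _ _ one_pos).ne' measure_ball_lt_top.ne
  have hvol : ∀ (x : Space n) (ϱ : ℝ), 0 < ϱ →
      volume.real (ball x ϱ) = ϱ ^ n * volume.real (ball (0 : Space n) 1) := fun x ϱ hϱ => by
    rw [Measure.real, Measure.addHaar_ball volume x hϱ.le, ENNReal.toReal_mul,
      ENNReal.toReal_ofReal (by positivity)]
    simp only [finrank_euclideanSpace, Fintype.card_fin]
    rfl
  have hpow : ∀ (x : Space n) (ϱ : ℝ), 0 < ϱ → cylinderHeight μ ϱ x =
      ϱ * ((∫ x in ball x ϱ, μ x) / volume.real (ball (0 : Space n) 1)) ^ (1 / (n : ℝ)) := by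
    intro x ϱ hϱ
    have hI : 0 ≤ ∫ x in ball x ϱ, μ x := integral_nonneg hμ
    rw [cylinderHeight, setAverage_eq, hvol x ϱ hϱ, smul_eq_mul, mul_inv, mul_assoc,
      Real.mul_rpow (by positivity) (by positivity), ← inv_pow, one_div,
      Real.pow_rpow_inv_natCast (by positivity) (by omega), inv_mul_eq_div _ (∫ x in _, μ x)]
    field_simp
  rw [hpow w R hR, hpow y r hr, div_mul_eq_mul_div, mul_div_assoc, mul_div_cancel_left₀ _ hr.ne']
  have hmono : ∫ x in ball w R, μ x ≤ ∫ x in ball y r, μ x :=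
    setIntegral_mono_set hμi (Eventually.of_forall hμ) hsub.eventuallyLE
  have hI : 0 ≤ ∫ x in ball w R, μ x := integral_nonneg hμ
  gcongr

theorem IsMuckenhoupt.cylinderHeight_pos (hn : 1 ≤ n) {ω : Space n → ℝ} {K₀ R : ℝ}
    (hω : IsMuckenhoupt (1 + 1 / (n : ℝ)) ω)
    (hK : muckenhouptConst (1 + 1 / (n : ℝ)) ω ≤ ENNReal.ofReal K₀) (w : Space n) (hR : 0 < R) :
    0 < cylinderHeight (dualWeight ω) R w := by
  have h1 := hω.one_le_average_mul hn hK w hR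
  have h2 : 0 < (⨍ x in ball w R, dualWeight ω x) ^ (1 / (n : ℝ)) := by
    by_contra! hcon
    have := mul_nonpos_of_nonneg_of_nonpos (hω.setAverage_pos w hR).le hcon
    linarith
  rw [cylinderHeight]
  positivity

/-- The new centre divides the segment from y to z so that its distance to z is at most ρ and its
distance to y at most r - 2ρ. -/
theorem exists_doubled_ball (hn : 1 ≤ n) {z y : Space n} {ρ r : ℝ} (hρ : 0 < ρ) (hρr : ρ < r / 2)
    (hsub : ball z ρ ⊆ ball y r) :
    ∃ w : Space n, ball z ρ ⊆ ball w (2 * ρ) ∧ ball w (2 * ρ) ⊆ ball y r := by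
  have h1 := norm_sub_add_le_of_ball_subset hn hρ hsub
  have h2 : 0 < r - ρ := by linarith
  set θ := (r - 2 * ρ) / (r - ρ) with hθ
  have hθ0 : 0 ≤ θ := div_nonneg (by linarith) h2.le
  have hθ1 : 1 - θ = ρ / (r - ρ) := by rw [hθ]; field_simp; ring
  refine ⟨y + θ • (z - y), ball_subset_ball' ?_, ball_subset_ball' ?_⟩
  · have h3 : z - (y + θ • (z - y)) = (1 - θ) • (z - y) := by module
    rw [dist_eq_norm, h3, norm_smul, hθ1, Real.norm_of_nonneg (by positivity)]
    have : ρ / (r - ρ) * ‖z - y‖ ≤ ρ / (r - ρ) * (r - ρ) := by gcongr; linarith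
    rw [div_mul_cancel₀ _ h2.ne'] at this
    linarith
  · rw [dist_eq_norm, add_sub_cancel_left, norm_smul, Real.norm_of_nonneg hθ0]
    have : θ * ‖z - y‖ ≤ θ * (r - ρ) := by gcongr; linarith
    rw [hθ, div_mul_cancel₀ _ h2.ne'] at this
    linarith

theorem nonneg_on_closure {X : Type*} [TopologicalSpace X] {u : X → ℝ} {s : Set X}
    (hu : ContinuousOn u (closure s)) (h : ∀ x ∈ s, 0 ≤ u x) : ∀ x ∈ closure s, 0 ≤ u x := by
  have h1 : MapsTo u s (Ici 0) := h
  have h2 := h1.closure_of_continuousOn hu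
  rw [isClosed_Ici.closure_eq] at h2
  exact h2

/-- Induction on the number of doublings. The budget (h/2)H(2 - ρ/r), with H the full height, drops
by (h/2)H ρ/r when ρ doubles, and one step costs at most that. At least (h/2)H is left for the last
step, which takes all the remaining time. -/
theorem exists_chain (hn : 1 ≤ n) {ν K₀ h : ℝ} (hν : 0 < ν) (hν1 : ν < 1) (hK₀ : 1 ≤ K₀)
    (hh : 0 < h) (hh1 : h ≤ 1) :
    ∃ c ε : ℝ, 0 < c ∧ c < 1 ∧ 0 < ε ∧ ε < 1 ∧
      ∀ (ω : Space n → ℝ) (a : SpaceTime n → Matrix (Fin n) (Fin n) ℝ)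
        (r : ℝ) (y : Space n) (s : ℝ) (u : SpaceTime n → ℝ), 0 < r →
        IsMuckenhoupt (1 + 1 / (n : ℝ)) ω →
        muckenhouptConst (1 + 1 / (n : ℝ)) ω ≤ ENNReal.ofReal K₀ →
        bmoSeminorm ω ω (ball y (2 * r)) ≤ ENNReal.ofReal ε →
        IsElliptic ν a (cylinder (dualWeight ω) r (y, s)) →
        IsC21On u (cylinder (dualWeight ω) r (y, s)) →
        ContinuousOn u (closure (cylinder (dualWeight ω) r (y, s))) →
        (∀ X ∈ closure (cylinder (dualWeight ω) r (y, s)), 0 ≤ u X) →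
        (∀ᵐ X ∂(volume.restrict (cylinder (dualWeight ω) r (y, s))), 0 ≤ parabolicOp ω a u X) →
        ∀ σ ≤ s, ∀ (N : ℕ) (ρ : ℝ) (z : Space n) (τ M : ℝ), 0 < ρ → r ≤ 2 ^ (N + 1) * ρ →
          ball z ρ ⊆ ball y r → s - cylinderHeight (dualWeight ω) r y ≤ τ →
          h / 2 * cylinderHeight (dualWeight ω) r y * (2 - ρ / r) ≤ σ - τ → 0 ≤ M →
          (∀ x ∈ ball z (ρ / 2), M ≤ u (x, τ)) →
          ∀ x ∈ ball y (r / 2), c ^ (N + 1) * M ≤ u (x, σ) := by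
  obtain ⟨c, ε, hc0, hc1, hε0, hε1, hstep⟩ :=
    -- An intermediate step lasts exactly h/4 of the height of its own cylinder; the last one lasts
    -- longer than h/4 of the full height.
    exists_one_step hn hν hν1 hK₀ (show 0 < h / 4 by positivity)
  refine ⟨c, ε, hc0, hc1, hε0, hε1, ?_⟩
  intro ω a r y s u hr hω hconst hbmo hell hu huc hu0 hpde σ hσ
  set μ := dualWeight ω with hμdef
  set H := cylinderHeight μ r y with hH
  have hμi := hω.integrableOn_dualWeight hn hconst y hr
  have hH0 : 0 < H := hω.cylinderHeight_pos hn hconst y hr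
  have hcl : closure (cylinder μ r (y, s)) = closedBall y r ×ˢ Icc (s - H) s := by
    rw [cylinder, closure_prod_eq, closure_ball _ hr.ne', closure_Ioo (by linarith)]
  rw [hcl] at huc hu0
  have hsubstep : ∀ (z w : Space n) (R T t₀ ρ M : ℝ), 0 < R → ball w R ⊆ ball y r → 0 < T →
      s - H ≤ t₀ → t₀ + T ≤ s → h / 4 * cylinderHeight μ R w ≤ T → T ≤ cylinderHeight μ R w →
      R / 2 ≤ ρ → ball z ρ ⊆ ball w R → 0 ≤ M → (∀ x ∈ ball z (ρ / 2), M ≤ u (x, t₀)) →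
      ∀ x ∈ ball w (R / 2), c * M ≤ u (x, t₀ + T) := by
    intro z w R T t₀ ρ M hR hsub hT ht0 ht1 hκT hTH hρ hz hM hinit
    have hΩ : ball w R ×ˢ Ioo t₀ (t₀ + T) ⊆ cylinder μ r (y, s) :=
      prod_mono hsub (Ioo_subset_Ioo ht0 ht1)
    have hcb : closedBall w R ⊆ closedBall y r := by
      have := closure_mono hsub
      rwa [closure_ball _ hR.ne', closure_ball _ hr.ne'] at this
    have hK : closedBall w (3 * R / 4) ×ˢ Icc t₀ (t₀ + T) ⊆ closedBall y r ×ˢ Icc (s - H) s :=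
      prod_mono ((closedBall_subset_closedBall (by linarith)).trans hcb) (Icc_subset_Icc ht0 ht1)
    have hosc : meanOsc ω ω w R ≤ ENNReal.ofReal ε := by
      refine le_trans ?_ hbmo
      exact le_iSup₂_of_le w R (le_iSup₂_of_le hR
        (hsub.trans (ball_subset_ball (by linarith))) le_rfl)
    exact hstep ω a u z w R T t₀ ρ M hR hω hconst hosc hT hκT hTH (hell.mono hΩ) (hu.mono hΩ)
      (huc.mono hK) (fun X hX => hu0 X (hK hX)) (ae_restrict_of_ae_restrict_of_subset hΩ hpde)
      hρ hz hM hinit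
  have hlast : ∀ (z : Space n) (ρ τ M : ℝ), ρ ≤ r → r / 2 ≤ ρ → ball z ρ ⊆ ball y r →
      s - H ≤ τ → h / 2 * H * (2 - ρ / r) ≤ σ - τ → 0 ≤ M → (∀ x ∈ ball z (ρ / 2), M ≤ u (x, τ)) →
      ∀ x ∈ ball y (r / 2), c * M ≤ u (x, σ) := by
    intro z ρ τ M hρr hρ hz hτ hbud hM hinit x hx
    have h1 : ρ / r ≤ 1 := (div_le_one hr).2 hρr
    have h2 : h / 2 * H * 1 ≤ h / 2 * H * (2 - ρ / r) := by gcongr; linarith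
    have h3 : 0 < h * H := by positivity
    have := hsubstep z y r (σ - τ) τ ρ M hr Subset.rfl (by linarith) hτ (by linarith) (by linarith)
      (by linarith) hρ hz hM hinit x hx
    rwa [add_sub_cancel] at this
  intro N
  induction N with
  | zero =>
    intro ρ z τ M hρ hrρ hz hτ hbud hM hinit x hx
    have hρr : ρ ≤ r := by
      have := norm_sub_add_le_of_ball_subset hn hρ hz
      linarith [norm_nonneg (z - y)]
    rw [zero_add, pow_one]
    exact hlast z ρ τ M hρr (by rw [zero_add, pow_one] at hrρ; linarith) hz hτ hbud hM hinit x hx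
  | succ N ih =>
    intro ρ z τ M hρ hrρ hz hτ hbud hM hinit x hx
    have hρr : ρ ≤ r := by
      have := norm_sub_add_le_of_ball_subset hn hρ hz
      linarith [norm_nonneg (z - y)]
    by_cases hρ2 : r / 2 ≤ ρ
    -- The ball is already large, so a single step suffices and the surplus powers of c < 1 only
    -- weaken the claim.
    · refine le_trans ?_ (hlast z ρ τ M hρr hρ2 hz hτ hbud hM hinit x hx)
      gcongr
      exact pow_le_of_le_one hc0.le hc1.le (by omega)
    · rw [not_le] at hρ2
      obtain ⟨w, hzw, hwy⟩ := exists_doubled_ball hn hρ hρ2 hz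
      have hF := cylinderHeight_le hn hω.dualWeight_nonneg (show 0 < 2 * ρ by linarith) hr hμi hwy
      have hF0 : 0 < cylinderHeight μ (2 * ρ) w :=
        hω.cylinderHeight_pos hn hconst w (by linarith)
      set F := cylinderHeight μ (2 * ρ) w with hFdef
      have hT : h / 4 * F ≤ h / 2 * H * (ρ / r) := by
        have := mul_le_mul_of_nonneg_left hF (show 0 ≤ h / 4 by positivity)
        refine this.trans_eq ?_
        rw [← hH]; ring
      have h1 : ρ / r ≤ 1 := (div_le_one hr).2 hρr
      have hhH : 0 < h * H := by positivity
      have h2 : h / 2 * H * (ρ / r) ≤ h / 2 * H * 1 := by gcongr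
      have h3 : h / 2 * H * 1 ≤ h / 2 * H * (2 - ρ / r) := by gcongr; linarith
      have hnext := hsubstep z w (2 * ρ) (h / 4 * F) τ ρ M (by linarith) hwy (by positivity) hτ
        (by linarith) le_rfl (by nlinarith) (by linarith) hzw hM hinit
      have hTpos : 0 < h / 4 * F := by positivity
      have := ih (2 * ρ) w (τ + h / 4 * F) (c * M) (by linarith)
        (by rw [pow_succ] at hrρ; linarith) hwy (by linarith)
        (by
          have e : 2 * ρ / r = 2 * (ρ / r) := by ring
          rw [e]
          nlinarith) (by positivity) hnext x hx
      rw [pow_succ, mul_assoc]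
      exact this

end Chain

end PropUp

end

/-! ### Conversion of the chain length into a power of r/ρ -/

theorem corollary3p6 (n : ℕ) (hn : 1 ≤ n) (ν K₀ h : ℝ) (hν : 0 < ν) (hν1 : ν < 1)
    (hK₀ : 1 ≤ K₀) (hh : 0 < h) (hh1 : h ≤ 1) :
    ∃ γ ε : ℝ, 0 < γ ∧ 0 < ε ∧ ε < 1 ∧
      ∀ (ω : PropUp.Space n → ℝ) (a : PropUp.SpaceTime n → Matrix (Fin n) (Fin n) ℝ)
        (r : ℝ) (y : PropUp.Space n) (s : ℝ) (u : PropUp.SpaceTime n → ℝ),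
        0 < r →
        PropUp.IsMuckenhoupt (1 + 1 / (n : ℝ)) ω →
        PropUp.muckenhouptConst (1 + 1 / (n : ℝ)) ω ≤ ENNReal.ofReal K₀ →
        PropUp.bmoSeminorm ω ω (Metric.ball y (2 * r)) ≤ ENNReal.ofReal ε →
        PropUp.IsElliptic ν a (PropUp.cylinder (PropUp.dualWeight ω) r (y, s)) →
        PropUp.IsC21On u (PropUp.cylinder (PropUp.dualWeight ω) r (y, s)) →
        ContinuousOn u (closure (PropUp.cylinder (PropUp.dualWeight ω) r (y, s))) →
        (∀ X ∈ PropUp.cylinder (PropUp.dualWeight ω) r (y, s), 0 ≤ u X) →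
        (∀ᵐ X ∂(MeasureTheory.volume.restrict
            (PropUp.cylinder (PropUp.dualWeight ω) r (y, s))),
          0 ≤ PropUp.parabolicOp ω a u X) →
        ∀ (ρ : ℝ) (z : PropUp.Space n) (τ σ : ℝ), 0 < ρ → ρ ≤ r →
          Metric.ball z ρ ⊆ Metric.ball y r →
          s - PropUp.cylinderHeight (PropUp.dualWeight ω) r y ≤ τ →
          τ + h * PropUp.cylinderHeight (PropUp.dualWeight ω) r y ≤ σ →
          σ ≤ s →
          sInf ((fun x => u (x, τ)) '' Metric.ball z ρ) ≤
            (4 * r / ρ) ^ γ * sInf ((fun x => u (x, σ)) '' Metric.ball y (r / 2)) := by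
  obtain ⟨c, ε, hc0, hc1, hε0, hε1, hchain⟩ := PropUp.exists_chain hn hν hν1 hK₀ hh hh1
  have hγ : 0 < Real.logb 2 c⁻¹ := Real.logb_pos one_lt_two ((one_lt_inv₀ hc0).2 hc1)
  refine ⟨Real.logb 2 c⁻¹, ε, hγ, hε0, hε1, ?_⟩
  intro ω a r y s u hr hω hconst hbmo hell hu huc hu0 hpde ρ z τ σ hρ hρr hz hτ hτσ hσ
  -- The times τ and σ may be endpoints of the cylinder, so nonnegativity is needed on the closure.
  have hu0' := PropUp.nonneg_on_closure huc hu0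
  set H := PropUp.cylinderHeight (PropUp.dualWeight ω) r y with hH
  have hH0 : 0 < H := hω.cylinderHeight_pos hn hconst y hr
  have hhH : 0 ≤ h * H := by positivity
  have hbelow : ∀ t ∈ Set.Icc (s - H) s, ∀ x ∈ Metric.ball y r, 0 ≤ u (x, t) := by
    intro t ht x hx
    refine hu0' _ ?_
    rw [PropUp.cylinder, closure_prod_eq]
    refine ⟨subset_closure hx, ?_⟩
    change t ∈ closure (Set.Ioo (s - H) s)
    rw [closure_Ioo (by linarith)]
    exact ht
  -- 2^N ≤ r/ρ < 2^{N+1}: the upper bound lets the chain reach radius r, the lower one limits the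
  -- loss.
  obtain ⟨N, hN1, hN2⟩ := exists_nat_pow_near ((one_le_div hρ).2 hρr) one_lt_two
  set M := sInf ((fun x => u (x, τ)) '' Metric.ball z ρ) with hM
  have hτI : τ ∈ Set.Icc (s - H) s := ⟨hτ, by linarith⟩
  have hσI : σ ∈ Set.Icc (s - H) s := ⟨by linarith, hσ⟩
  have hM0 : 0 ≤ M := Real.sInf_nonneg (by
    rintro _ ⟨x, hx, rfl⟩
    exact hbelow τ hτI x (hz hx))
  have hMle : ∀ x ∈ Metric.ball z (ρ / 2), M ≤ u (x, τ) := fun x hx =>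
    csInf_le ⟨0, by
      rintro _ ⟨x, hx, rfl⟩
      exact hbelow τ hτI x (hz hx)⟩ ⟨x, Metric.ball_subset_ball (by linarith) hx, rfl⟩
  have hbud : h / 2 * H * (2 - ρ / r) ≤ σ - τ := by
    have h1 : 0 ≤ ρ / r := by positivity
    have h2 : h / 2 * H * (2 - ρ / r) ≤ h / 2 * H * 2 := by gcongr; linarith
    linarith
  have hfin := hchain ω a r y s u hr hω hconst hbmo hell hu huc hu0' hpde σ hσ N ρ z τ M hρ
    (by rw [div_lt_iff₀ hρ] at hN2; exact hN2.le) hz hτ hbud hM0 hMle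
  have hinf : c ^ (N + 1) * M ≤ sInf ((fun x => u (x, σ)) '' Metric.ball y (r / 2)) := by
    refine le_csInf ((Metric.nonempty_ball.2 (by positivity)).image _) ?_
    rintro _ ⟨x, hx, rfl⟩
    exact hfin x hx
  -- With γ = log₂(1/c) the loss c^{-(N+1)} equals (2^{N+1})^γ, and 2^{N+1} ≤ 2r/ρ.
  have hpow : (c ^ (N + 1))⁻¹ ≤ (4 * r / ρ) ^ Real.logb 2 c⁻¹ := by
    have h1 : (2 : ℝ) ^ (N + 1) ≤ 4 * r / ρ := by
      rw [pow_succ, mul_div_assoc]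
      have : 0 < r / ρ := by positivity
      linarith
    calc (c ^ (N + 1))⁻¹ = ((2 : ℝ) ^ (N + 1)) ^ Real.logb 2 c⁻¹ := by
          rw [← Real.rpow_natCast 2, ← Real.rpow_mul (by norm_num), mul_comm, Real.rpow_mul
            (by norm_num), Real.rpow_logb (by norm_num) (by norm_num) (inv_pos.2 hc0),
            Real.rpow_natCast, inv_pow]
      _ ≤ _ := Real.rpow_le_rpow (by positivity) h1 hγ.le
  calc M = (c ^ (N + 1))⁻¹ * (c ^ (N + 1) * M) := by
        rw [inv_mul_cancel_left₀ (by positivity)]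
    _ ≤ _ := mul_le_mul hpow hinf (by positivity) (by positivity)
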